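/- **The dyadic half-line.** Let $\mathbb D$ be the set of two-sided sequences $x=(x_j)_{j\in\mathbb Z}$, $x_j\in\{0,1\}$, with $x_j=0$ for all sufficiently large $j$, with the digitwise addition modulo $2$, denoted $\oplus$ (so that $\ominus=\oplus$). The sequence $x$ represents the number $|x|=\sum_j x_j2^j\in[0,\infty)$, and inequalities between points and numbers refer to $|x|$; $2x$ is the shifted sequence $(x_{j-1})_j$, and a non-negative integer $k$ is identified with the sequence of its finite binary expansion. A function $f:\mathbb D\to\mathbb R$ is *$W$-continuous* if $\lim_{h\to0}|f(x\oplus h)-f(x)|=0$ for every $x\in\mathbb D$. **The equation.** Let $n\ge1$, $N=2^{n-1}$, and let $c_0,\dots,c_{2^n-1}$ be real numbers with $\sum_{k} c_{2k}=\sum_{k} c_{2k+1}=1$. A *continuous solution* of the dyadic refinement equation $$\varphi(t)=\sum_{k=0}^{2^n-1}c_k\,\varphi(2t\ominus k),\qquad t\in\mathbb D,$$ is a $W$-continuous, compactly supported, not identically zero function $\varphi:\mathbb D\to\mathbb R$ that satisfies it. **The operators.** Let $T_0,T_1$ be the $N\times N$ matrices $(T_0)_{ij}=c_{2(i-1)\oplus(j-1)}$,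 $(T_1)_{ij}=c_{(2i-1)\oplus(j-1)}$, $1\le i,j\le N$, and $W=\{x\in\mathbb R^N:\sum_i x_i=1\}$, which is invariant under both. For an eigenvector $v\in W$ of $T_0$ with eigenvalue $1$, let $V=V(v)\subset W$ be the smallest affine subspace that contains $v$ and is invariant under $T_0$ and $T_1$, let $A_d=T_d|_V$, $d=0,1$, and let $\rho(A_0,A_1)=\lim_{r\to\infty}\max_{d\in\{0,1\}^r}\|A_{d_1}\cdots A_{d_r}\|^{1/r}$ be the joint spectral radius of (the linear parts of) $A_0,A_1$. **The exponent.** The dyadic modulus of continuity of $f$ is $w(f,\delta)=\sup\{|f(x\oplus y)-f(x)|:\ x,y\in[0,2^{n-1}),\ 0\le y<\delta\}$. The dyadic Hölder exponent $\alpha_f\in[0,\infty]$ is the supremum of all $\alpha>0$ for which there is a constant $C$ with $w(f,\delta)\le C\delta^{\alpha}$ for all $\delta>0$. **Theorem.** 1. If the eigenvector $v\in W$ of $T_0$ with eigenvalue $1$ exists and is unique, then the refinement equation has a continuous solution if and only if $\rho(A_0,A_1)<1$. 2. In general, the refinement equation has a continuous solution if and only if $T_0$ has an eigenvector $v\in W$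 with eigenvalue $1$ for which the corresponding operators satisfy $\rho(A_0,A_1)<1$. 3. If $\varphi$ is a continuous solution and $v\in W$ is an eigenvector of $T_0$ with eigenvalue $1$ for which $\rho(A_0,A_1)<1$, then $\alpha_\varphi=-\log_2\rho(A_0,A_1)$, where $-\log_2 0=+\infty$. -/

import Mathlib

open Filter Topology
open scoped ENNReal NNReal

/-! ### The dyadic half-line -/

/-- The dyadic half-line: two-sided binary sequences `x` with `x j = 0` for all sufficiently
large `j`; the sequence `x` stands for the number `∑ⱼ xⱼ 2ʲ`. The digitwise operation `⊕` is the
addition of this group, and `⊖` is its subtraction (the two coincide). -/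
def dyadicSequences : AddSubgroup (ℤ → ZMod 2) where
  carrier := {x | ∃ k : ℤ, ∀ j, k < j → x j = 0}
  zero_mem' := ⟨0, fun _ _ => rfl⟩
  add_mem' := by
    rintro x y ⟨k, hk⟩ ⟨l, hl⟩
    refine ⟨max k l, fun j hj => ?_⟩
    simp [hk j (lt_of_le_of_lt (le_max_left _ _) hj), hl j (lt_of_le_of_lt (le_max_right _ _) hj)]
  neg_mem' := by
    rintro x ⟨k, hk⟩
    exact ⟨k, fun j hj => by simp [hk j hj]⟩

/-- The type of points of the dyadic half-line. -/
abbrev DyadicHalfLine : Type := dyadicSequences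

namespace DyadicHalfLine

/-- The digit of `x` in front of `2 ^ j`. -/
def digit (x : DyadicHalfLine) (j : ℤ) : ZMod 2 := (x : ℤ → ZMod 2) j

/-- The non-negative real number `∑ⱼ xⱼ 2ʲ` with binary digits `xⱼ`. -/
noncomputable def value (x : DyadicHalfLine) : ℝ := ∑' j : ℤ, ((x.digit j).val : ℝ) * (2 : ℝ) ^ j

/-- The series defining `value` converges. -/
theorem summable_value (x : DyadicHalfLine) :
    Summable fun j : ℤ => ((x.digit j).val : ℝ) * (2 : ℝ) ^ j := by
  obtain ⟨k, hk⟩ := x.2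
  refine Summable.of_nat_of_neg ?_ ?_
  · refine summable_of_ne_finset_zero (s := Finset.range (k.toNat + 1)) fun n hn => ?_
    have hn' : k < (n : ℤ) := by
      simp only [Finset.mem_range, not_lt] at hn
      omega
    have : x.digit n = 0 := hk n hn'
    simp [this]
  · refine Summable.of_nonneg_of_le (fun n => by positivity) (fun n => ?_)
      (summable_geometric_of_lt_one (r := (1 / 2 : ℝ)) (by norm_num) (by norm_num))
    have h1 : ((x.digit (-(n : ℤ))).val : ℝ) ≤ 1 := by
      have := ZMod.val_lt (x.digit (-(n : ℤ)))
      exact_mod_cast Nat.lt_succ_iff.mp this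
    have h2 : (2 : ℝ) ^ (-(n : ℤ)) = (1 / 2 : ℝ) ^ n := by simp
    rw [h2]
    exact mul_le_of_le_one_left (by positivity) h1

/-- The doubling `x ↦ 2x`, a shift of the digits. -/
def double (x : DyadicHalfLine) : DyadicHalfLine :=
  ⟨fun j => x.digit (j - 1), by
    obtain ⟨k, hk⟩ := x.2
    exact ⟨k + 1, fun j hj => hk (j - 1) (by omega)⟩⟩

/-- The natural number `k` as a point of the dyadic half-line, through its finite binary
expansion. -/
def ofNat (k : ℕ) : DyadicHalfLine :=
  ⟨fun j => if 0 ≤ j ∧ k.testBit j.toNat then 1 else 0, by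
    refine ⟨k, fun j hj => ?_⟩
    have h : k < 2 ^ j.toNat := lt_of_le_of_lt (by omega) (Nat.lt_two_pow_self (n := j.toNat))
    simp [Nat.testBit_lt_two_pow h]⟩

end DyadicHalfLine

/-- `f` is `W`-continuous: at every point `x`, `|f (x ⊕ h) - f x| → 0` as `h → 0`. -/
def WContinuous (f : DyadicHalfLine → ℝ) : Prop :=
  ∀ x, Tendsto (fun h => |f (x + h) - f x|) (comap DyadicHalfLine.value (𝓝 0)) (𝓝 0)

/-- `f` has compact support: it vanishes at all sufficiently large points. -/
def DyadicCompactSupport (f : DyadicHalfLine → ℝ) : Prop :=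
  ∃ R : ℝ, ∀ x, R < x.value → f x = 0

/-- `φ` is a continuous solution of the refinement equation
`φ(t) = ∑ₖ cₖ φ(2t ⊖ k)`, `0 ≤ k < 2 ^ (m + 1)`, on the dyadic half-line: a `W`-continuous,
compactly supported function, not identically zero, which satisfies the equation at every point. -/
structure IsContinuousRefinable (m : ℕ) (c : ℕ → ℝ) (φ : DyadicHalfLine → ℝ) : Prop where
  wContinuous : WContinuous φ
  compactSupport : DyadicCompactSupport φ
  ne_zero : φ ≠ 0
  refinement : ∀ t, φ t =
    ∑ k ∈ Finset.range (2 ^ (m + 1)), c k * φ (t.double - DyadicHalfLine.ofNat k)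

/-! ### The dyadic Hölder exponent -/

/-- The dyadic modulus of continuity on `[0, 2 ^ m)`: the supremum of `|f (x ⊕ y) - f x|` over
`x, y ∈ [0, 2 ^ m)` with `0 ≤ y < δ`. -/
noncomputable def dyadicModulus (m : ℕ) (f : DyadicHalfLine → ℝ) (δ : ℝ) : ℝ≥0∞ :=
  ⨆ (x : DyadicHalfLine) (y : DyadicHalfLine) (_ : x.value < 2 ^ m) (_ : y.value < 2 ^ m)
    (_ : y.value < δ), ENNReal.ofReal |f (x + y) - f x|

/-- The dyadic Hölder exponent: the supremum of the `α > 0` for which the modulus of continuity is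
at most `C δ ^ α` for all `δ > 0`, with a constant `C` that may depend on `f` and `α`. It may be
infinite. -/
noncomputable def dyadicHolderExponent (m : ℕ) (f : DyadicHalfLine → ℝ) : EReal :=
  ⨆ (α : ℝ) (_ : 0 < α)
    (_ : ∃ C : ℝ≥0, ∀ δ : ℝ, 0 < δ → dyadicModulus m f δ ≤ C * ENNReal.ofReal (δ ^ α)), (α : EReal)

/-- `-log₂ r` for `r ≥ 0`, with `-log₂ 0 = +∞`. -/
noncomputable def negLogTwo (r : ℝ) : EReal :=
  if r = 0 then ⊤ else ((-Real.logb 2 r : ℝ) : EReal)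

/-! ### The joint spectral radius -/

section JointSpectralRadius

variable {E : Type*} [NormedAddCommGroup E] [NormedSpace ℝ E]

/-- The maximum of `‖A_{d₁} ⋯ A_{dᵣ}‖ ^ (1 / r)` over all `(d₁, …, dᵣ) ∈ {0, 1} ^ r`. -/
noncomputable def jointSpectralMax (A : Fin 2 → E →L[ℝ] E) (r : ℕ) : ℝ :=
  ⨆ d : Fin r → Fin 2, ‖(List.ofFn fun i => A (d i)).prod‖ ^ (1 / (r : ℝ))

/-- The joint spectral radius `lim_{r → ∞} max_d ‖A_{d₁} ⋯ A_{dᵣ}‖ ^ (1 / r)`. -/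
noncomputable def jointSpectralRadius (A : Fin 2 → E →L[ℝ] E) : ℝ :=
  limUnder atTop (jointSpectralMax A)

/-- The maximum of `‖A_{d₁} ⋯ A_{dᵣ}‖` over words of length `r`. -/
noncomputable def maxProductNorm (A : Fin 2 → E →L[ℝ] E) (r : ℕ) : ℝ :=
  ⨆ d : Fin r → Fin 2, ‖(List.ofFn fun i => A (d i)).prod‖

theorem le_maxProductNorm (A : Fin 2 → E →L[ℝ] E) (r : ℕ) (d : Fin r → Fin 2) :
    ‖(List.ofFn fun i => A (d i)).prod‖ ≤ maxProductNorm A r :=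
  le_ciSup (f := fun d : Fin r → Fin 2 => ‖(List.ofFn fun i => A (d i)).prod‖)
    (Set.finite_range _).bddAbove d

theorem maxProductNorm_nonneg (A : Fin 2 → E →L[ℝ] E) (r : ℕ) : 0 ≤ maxProductNorm A r :=
  (norm_nonneg _).trans (le_maxProductNorm A r fun _ => 0)

theorem maxProductNorm_add (A : Fin 2 → E →L[ℝ] E) (r s : ℕ) :
    maxProductNorm A (r + s) ≤ maxProductNorm A r * maxProductNorm A s := by
  refine ciSup_le fun d => ?_
  rw [List.ofFn_add, List.prod_append]
  exact (norm_mul_le _ _).trans (mul_le_mul (le_maxProductNorm A r fun i => d (Fin.castAdd s i))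
    (le_maxProductNorm A s fun i => d (Fin.natAdd r i)) (norm_nonneg _)
    (maxProductNorm_nonneg A r))

theorem jointSpectralMax_eq (A : Fin 2 → E →L[ℝ] E) (r : ℕ) :
    jointSpectralMax A r = maxProductNorm A r ^ (1 / (r : ℝ)) := by
  refine le_antisymm (ciSup_le fun d => ?_) ?_
  · exact Real.rpow_le_rpow (norm_nonneg _) (le_maxProductNorm A r d) (by positivity)
  · obtain ⟨d, hd⟩ := exists_eq_ciSup_of_finite
      (f := fun d : Fin r → Fin 2 => ‖(List.ofFn fun i => A (d i)).prod‖)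
    rw [maxProductNorm, ← hd]
    exact le_ciSup
      (f := fun d : Fin r → Fin 2 => ‖(List.ofFn fun i => A (d i)).prod‖ ^ (1 / (r : ℝ)))
      (Set.finite_range _).bddAbove d

/-- The limit that defines the joint spectral radius exists. -/
theorem tendsto_jointSpectralMax (A : Fin 2 → E →L[ℝ] E) :
    Tendsto (jointSpectralMax A) atTop (𝓝 (jointSpectralRadius A)) := by
  suffices h : ∃ L, Tendsto (jointSpectralMax A) atTop (𝓝 L) from tendsto_nhds_limUnder h
  by_cases h0 : ∃ r, maxProductNorm A r = 0
  · obtain ⟨r, hr⟩ := h0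
    refine ⟨0, tendsto_const_nhds.congr' ?_⟩
    filter_upwards [eventually_ge_atTop (r + 1)] with s hs
    have h1 : maxProductNorm A s = 0 := by
      refine le_antisymm ?_ (maxProductNorm_nonneg A s)
      have := maxProductNorm_add A r (s - r)
      rwa [hr, zero_mul, Nat.add_sub_cancel' (by omega)] at this
    have hs0 : (s : ℝ) ≠ 0 := by
      have : s ≠ 0 := by omega
      exact_mod_cast this
    rw [jointSpectralMax_eq, h1, Real.zero_rpow (one_div_ne_zero hs0)]
  · push Not at h0
    have hpos : ∀ r, 0 < maxProductNorm A r := fun r =>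
      lt_of_le_of_ne (maxProductNorm_nonneg A r) (h0 r).symm
    have hsub : Subadditive fun r => Real.log (maxProductNorm A r) := fun r s => by
      rw [← Real.log_mul (h0 r) (h0 s)]
      exact Real.log_le_log (hpos _) (maxProductNorm_add A r s)
    have hexp : ∀ r : ℕ, jointSpectralMax A r
        = Real.exp (Real.log (maxProductNorm A r) / r) := fun r => by
      rw [jointSpectralMax_eq, Real.rpow_def_of_pos (hpos r), mul_one_div]
    rw [show jointSpectralMax A = _ from funext hexp]
    by_cases hb : BddBelow (Set.range fun r : ℕ => Real.log (maxProductNorm A r) / r)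
    · exact ⟨_, (Real.continuous_exp.tendsto _).comp (hsub.tendsto_lim hb)⟩
    · refine ⟨0, Real.tendsto_exp_atBot.comp (tendsto_atBot.2 fun b => ?_)⟩
      rw [not_bddBelow_iff] at hb
      obtain ⟨_, ⟨n, rfl⟩, hn⟩ := hb (min b 0)
      have hn0 : n ≠ 0 := by
        rintro rfl
        simp at hn
      exact (hsub.eventually_div_lt_of_div_lt hn0 (hn.trans_le (min_le_left _ _))).mono
        fun _ h => h.le

end JointSpectralRadius

/-! ### The matrices of the mask and the minimal affine subspace -/

/-- The two `2 ^ m × 2 ^ m` matrices `T₀`, `T₁` of the mask `c₀, …, c_{2 ^ (m + 1) - 1}`; with rows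
and columns numbered from `0`, `(T_d)ᵢⱼ = c_{(2 i + d) ⊕ j}`. -/
def maskMatrix (m : ℕ) (c : ℕ → ℝ) (d : Fin 2) : Matrix (Fin (2 ^ m)) (Fin (2 ^ m)) ℝ :=
  Matrix.of fun i j => c ((2 * (i : ℕ) + (d : ℕ)) ^^^ (j : ℕ))

/-- `T_d` as an affine map of `ℝ ^ (2 ^ m)`. -/
noncomputable def maskMap (m : ℕ) (c : ℕ → ℝ) (d : Fin 2) :
    (Fin (2 ^ m) → ℝ) →ᵃ[ℝ] (Fin (2 ^ m) → ℝ) :=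
  (Matrix.toLin' (maskMatrix m c d)).toAffineMap

/-- `v` is an eigenvector of `T₀` with eigenvalue `1` that lies in the affine hyperplane
`W = {x | ∑ᵢ xᵢ = 1}`. -/
def IsNormalizedEigenvector (m : ℕ) (c : ℕ → ℝ) (v : Fin (2 ^ m) → ℝ) : Prop :=
  (maskMatrix m c 0).mulVec v = v ∧ ∑ i, v i = 1

/-- The smallest affine subspace `V` that contains `v` and is mapped into itself by both `T₀` and
`T₁`. (When `W` is invariant and `v ∈ W`, it lies in `W`.) -/
noncomputable def minimalSubspace (m : ℕ) (c : ℕ → ℝ) (v : Fin (2 ^ m) → ℝ) :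
    AffineSubspace ℝ (Fin (2 ^ m) → ℝ) :=
  sInf {S | v ∈ S ∧ ∀ d, S.map (maskMap m c d) ≤ S}

theorem mem_minimalSubspace (m : ℕ) (c : ℕ → ℝ) (v : Fin (2 ^ m) → ℝ) :
    v ∈ minimalSubspace m c v := by
  rw [minimalSubspace, AffineSubspace.mem_sInf_iff]
  exact fun S hS => hS.1

theorem map_minimalSubspace_le (m : ℕ) (c : ℕ → ℝ) (v : Fin (2 ^ m) → ℝ) (d : Fin 2) :
    (minimalSubspace m c v).map (maskMap m c d) ≤ minimalSubspace m c v := by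
  refine le_sInf fun S hS => ?_
  exact (AffineSubspace.map_mono _ (sInf_le hS)).trans (hS.2 d)

instance minimalSubspace_nonempty (m : ℕ) (c : ℕ → ℝ) (v : Fin (2 ^ m) → ℝ) :
    Nonempty (minimalSubspace m c v) := ⟨⟨v, mem_minimalSubspace m c v⟩⟩

/-- The affine operators `A_d = T_d|_V`, `d = 0, 1`. -/
noncomputable def restrictedOperator (m : ℕ) (c : ℕ → ℝ) (v : Fin (2 ^ m) → ℝ) (d : Fin 2) :
    minimalSubspace m c v →ᵃ[ℝ] minimalSubspace m c v :=
  (maskMap m c d).restrict (map_minimalSubspace_le m c v d)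

/-- The joint spectral radius `ρ(A₀, A₁)` of the affine operators `A₀`, `A₁`, that is, of their
linear parts on the direction of `V` (any norm gives the same value). -/
noncomputable def restrictedJSR (m : ℕ) (c : ℕ → ℝ) (v : Fin (2 ^ m) → ℝ) : ℝ :=
  jointSpectralRadius fun d =>
    LinearMap.toContinuousLinearMap (restrictedOperator m c v d).linear

/-! Splitting a point into its integer part `i` and its fractional digits `s` turns `φ` into the
vector function `γ s = (φ (point i s))ᵢ`. The equation forces `φ` to vanish for `i ≥ 2 ^ m`, so `γ
s` lives in `ℝ ^ (2 ^ m)`. The equation then reads `γ (d, s) = T_d (γ s)`, and `W`-continuity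
becomes uniform continuity of `γ` on the Cantor set. Continuous solutions thus correspond to nonzero
refinement curves.

For a curve with `γ 0 = v` one has `T_w (T_w' v - v) = γ (w w' 0…) - γ (w 0…)`, and the vectors
`T_w' v - v` span the direction of `V`. The oscillation of `γ` on cylinders of depth `r` therefore
bounds the products of length `r` up to a constant (`exists_maxProductNorm_le`), and growth bounds
for the products give back bounds for the oscillation (`exists_norm_sub_le`). So a curve forces `ρ <
1`. Conversely, `ρ < 1` makes `T_{d₁} ⋯ T_{dᵣ} v` converge geometrically to a curve. The Hölder
exponent is `-log₂ ρ`, because agreement in `r` digits means a displacement of size at most `2 ^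
(-r)`.

Two points remain: `∑ᵢ (γ 0)ᵢ ≠ 0` for a nonzero curve, so that it can be normalized, and, for the
exponent, equality of the given `v` with the normalized initial point of the curve of `φ`. Both
follow from `IsRefinementCurve.eq_zero`. The mean `(T₀ + T₁) / 2` is nilpotent on zero-sum vectors
and maps the convex hull of the curve into itself, so a zero-sum initial point puts `0` in that
hull. Applying `T_w` puts `0` in the hull of every piece of the curve, and the pieces shrink to
points. -/

/-! ### Points of the dyadic half-line by integer and fractional digits -/

/-- The sequence `d, s 0, s 1, …`. -/
def consDigit (d : Fin 2) (s : ℕ → Fin 2) : ℕ → Fin 2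
  | 0 => d
  | n + 1 => s n

theorem consDigit_head_tail (s : ℕ → Fin 2) : consDigit (s 0) (fun n => s (n + 1)) = s := by
  funext n
  cases n <;> rfl

/-- The sequences `s` and `s'` agree in their first `r` digits. -/
def AgreeUpTo (r : ℕ) (s s' : ℕ → Fin 2) : Prop := ∀ n < r, s n = s' n

theorem AgreeUpTo.mono {r r' : ℕ} {s s' : ℕ → Fin 2} (h : AgreeUpTo r s s') (hr : r' ≤ r) :
    AgreeUpTo r' s s' := fun n hn => h n (hn.trans_le hr)

theorem AgreeUpTo.symm {r : ℕ} {s s' : ℕ → Fin 2} (h : AgreeUpTo r s s') :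
    AgreeUpTo r s' s := fun n hn => (h n hn).symm

theorem AgreeUpTo.trans {r : ℕ} {s s' s'' : ℕ → Fin 2} (h : AgreeUpTo r s s')
    (h' : AgreeUpTo r s' s'') : AgreeUpTo r s s'' := fun n hn => (h n hn).trans (h' n hn)

theorem AgreeUpTo.consDigit {r : ℕ} {s s' : ℕ → Fin 2} (h : AgreeUpTo r s s') (d : Fin 2) :
    AgreeUpTo (r + 1) (consDigit d s) (consDigit d s') := by
  intro n hn
  cases n with
  | zero => rfl
  | succ n => exact h n (by omega)

namespace DyadicHalfLine

@[ext]
theorem ext_digit {x y : DyadicHalfLine} (h : ∀ j, x.digit j = y.digit j) : x = y :=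
  Subtype.ext (funext h)

@[simp]
theorem digit_add (x y : DyadicHalfLine) (j : ℤ) : (x + y).digit j = x.digit j + y.digit j := rfl

@[simp]
theorem digit_double (x : DyadicHalfLine) (j : ℤ) : x.double.digit j = x.digit (j - 1) := rfl

theorem add_self (x : DyadicHalfLine) : x + x = 0 := by
  ext j
  exact CharTwo.add_self_eq_zero _

theorem sub_eq_add (x y : DyadicHalfLine) : x - y = x + y := by
  rw [sub_eq_iff_eq_add, add_assoc, add_self, add_zero]

/-- The point with integer part `i` and fractional binary digits `s 0, s 1, …`. -/
def point (i : ℕ) (s : ℕ → Fin 2) : DyadicHalfLine :=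
  ⟨fun j => match j with
    | Int.ofNat n => if i.testBit n then 1 else 0
    | Int.negSucc n => s n, by
    refine ⟨i, fun j hj => ?_⟩
    obtain ⟨n, rfl⟩ := Int.eq_ofNat_of_zero_le (a := j) (by omega)
    have h : i < 2 ^ n := lt_of_lt_of_le (by omega) (Nat.lt_two_pow_self (n := n)).le
    simp [Nat.testBit_lt_two_pow h]⟩

@[simp]
theorem digit_point_natCast (i : ℕ) (s : ℕ → Fin 2) (n : ℕ) :
    (point i s).digit n = if i.testBit n then 1 else 0 := rfl

@[simp]
theorem digit_point_negSucc (i : ℕ) (s : ℕ → Fin 2) (n : ℕ) :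
    (point i s).digit (Int.negSucc n) = s n := rfl

@[simp]
theorem digit_ofNat_natCast (i : ℕ) (n : ℕ) :
    (ofNat i).digit n = if i.testBit n then 1 else 0 := by
  simp [ofNat, digit]

@[simp]
theorem digit_ofNat_negSucc (i : ℕ) (n : ℕ) : (ofNat i).digit (Int.negSucc n) = 0 := by
  simp [ofNat, digit]

theorem ext_digit_of_natCast_of_negSucc {x y : DyadicHalfLine}
    (h : ∀ n : ℕ, x.digit n = y.digit n)
    (h' : ∀ n : ℕ, x.digit (Int.negSucc n) = y.digit (Int.negSucc n)) : x = y := by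
  ext j
  cases j with
  | ofNat n => exact h n
  | negSucc n => exact h' n

theorem point_injective {i i' : ℕ} {s s' : ℕ → Fin 2} (h : point i s = point i' s') :
    i = i' ∧ s = s' := by
  constructor
  · refine Nat.eq_of_testBit_eq fun n => ?_
    have := congrArg (fun x => digit x n) h
    simp only [digit_point_natCast] at this
    by_cases h1 : i.testBit n <;> by_cases h2 : i'.testBit n <;> simp_all
  · funext n
    exact congrArg (fun x => digit x (Int.negSucc n)) h

theorem exists_eq_point_of_digit_eq_zero {k : ℕ} {x : DyadicHalfLine}
    (hx : ∀ j : ℤ, k ≤ j → x.digit j = 0) : ∃ i < 2 ^ k, ∃ s, x = point i s := by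
  refine ⟨Nat.ofBits fun j : Fin k => decide (x.digit (j : ℕ) = 1), Nat.ofBits_lt_two_pow _,
    fun n => x.digit (Int.negSucc n), ext_digit_of_natCast_of_negSucc (fun n => ?_) fun n => rfl⟩
  refine Eq.trans ?_ (digit_point_natCast _ _ n).symm
  by_cases hn : n < k
  · rw [Nat.testBit_ofBits_lt _ _ hn]
    simp only [decide_eq_true_eq]
    generalize x.digit (n : ℤ) = a
    revert a
    decide
  · rw [hx n (by omega), Nat.testBit_ofBits_ge _ _ (by omega)]
    simp

theorem exists_eq_point (x : DyadicHalfLine) : ∃ i s, x = point i s := by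
  obtain ⟨k, hk⟩ := x.2
  obtain ⟨i, -, s, h⟩ := exists_eq_point_of_digit_eq_zero (k := k.toNat + 1) (x := x)
    fun j hj => hk j (by omega)
  exact ⟨i, s, h⟩

theorem point_add_point (i i' : ℕ) (s s' : ℕ → Fin 2) :
    point i s + point i' s' = point (i ^^^ i') (s + s') := by
  refine ext_digit_of_natCast_of_negSucc (fun n => ?_) fun n => rfl
  simp only [digit_add, digit_point_natCast, Nat.testBit_xor]
  by_cases h1 : i.testBit n <;> by_cases h2 : i'.testBit n <;> simp [h1, h2]
  exact CharTwo.add_self_eq_zero _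

theorem ofNat_eq_point (i : ℕ) : ofNat i = point i 0 := by
  refine ext_digit_of_natCast_of_negSucc (fun n => ?_) fun n => ?_
  · rw [digit_ofNat_natCast, digit_point_natCast]
  · rw [digit_ofNat_negSucc, digit_point_negSucc]
    rfl

theorem double_point (i : ℕ) (d : Fin 2) (s : ℕ → Fin 2) :
    (point i (consDigit d s)).double = point (2 * i + d) s := by
  refine ext_digit_of_natCast_of_negSucc (fun n => ?_) fun n => ?_
  · rw [digit_double, digit_point_natCast]
    cases n with
    | zero =>
      have : ((0 : ℕ) : ℤ) - 1 = Int.negSucc 0 := rfl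
      rw [this, digit_point_negSucc]
      fin_cases d <;> simp [consDigit] <;> rfl
    | succ n =>
      have : ((n + 1 : ℕ) : ℤ) - 1 = n := by push_cast; ring
      rw [this, digit_point_natCast, Nat.testBit_succ]
      have h : (2 * i + (d : ℕ)) / 2 = i := by omega
      rw [h]
  · have : Int.negSucc n - 1 = Int.negSucc (n + 1) := rfl
    rw [digit_double, this, digit_point_negSucc, digit_point_negSucc]
    rfl

/-- Doubling moves the first fractional digit into the integer part, and subtracting `k` alters only
the integer part. All terms of the refinement equation thus share the tail `s`, which is what makes
it a matrix equation. -/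
theorem double_point_sub_ofNat (i : ℕ) (d : Fin 2) (s : ℕ → Fin 2) (k : ℕ) :
    (point i (consDigit d s)).double - ofNat k = point ((2 * i + d) ^^^ k) s := by
  rw [double_point, sub_eq_add, ofNat_eq_point, point_add_point, add_zero]

/-! ### Comparison of the value with powers of two -/

theorem value_eq_tsum {k : ℤ} {x : DyadicHalfLine} (hx : ∀ j, k ≤ j → x.digit j = 0) :
    x.value = ∑' n : ℕ, ((x.digit (k - 1 - n)).val : ℝ) * (2 : ℝ) ^ (k - 1 - n) := by
  have hinj : Function.Injective fun n : ℕ => k - 1 - (n : ℤ) := fun a b h => by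
    simpa using h
  refine (hinj.tsum_eq (f := fun j : ℤ => ((x.digit j).val : ℝ) * (2 : ℝ) ^ j) ?_).symm
  intro j hj
  by_contra hj'
  refine hj ?_
  have : k ≤ j := by
    by_contra hlt
    exact hj' ⟨(k - 1 - j).toNat, by
      simp only
      omega⟩
  simp [hx j this]

theorem two_zpow_sub_eq (k : ℤ) (n : ℕ) :
    (2 : ℝ) ^ (k - 1 - n) = (2 : ℝ) ^ k / 2 / 2 ^ n := by
  rw [zpow_sub₀ two_ne_zero, zpow_sub₀ two_ne_zero, zpow_one, zpow_natCast]

theorem summable_two_zpow_sub (k : ℤ) : Summable fun n : ℕ => (2 : ℝ) ^ (k - 1 - n) := by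
  simp only [two_zpow_sub_eq]
  exact summable_geometric_two' _

theorem tsum_two_zpow_sub (k : ℤ) : ∑' n : ℕ, (2 : ℝ) ^ (k - 1 - n) = 2 ^ k := by
  simp only [two_zpow_sub_eq]
  exact tsum_geometric_two' _

theorem val_digit_mul_le (x : DyadicHalfLine) (j : ℤ) :
    ((x.digit j).val : ℝ) * (2 : ℝ) ^ j ≤ 2 ^ j := by
  have h1 : ((x.digit j).val : ℝ) ≤ 1 := by
    exact_mod_cast Nat.lt_succ_iff.mp (ZMod.val_lt (x.digit j))
  exact mul_le_of_le_one_left (by positivity) h1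

theorem summable_digits (x : DyadicHalfLine) (k : ℤ) :
    Summable fun n : ℕ => ((x.digit (k - 1 - n)).val : ℝ) * (2 : ℝ) ^ (k - 1 - n) :=
  Summable.of_nonneg_of_le (fun n => by positivity) (fun n => val_digit_mul_le x _)
    (summable_two_zpow_sub k)

theorem value_le {k : ℤ} {x : DyadicHalfLine} (hx : ∀ j, k ≤ j → x.digit j = 0) :
    x.value ≤ 2 ^ k := by
  rw [value_eq_tsum hx, ← tsum_two_zpow_sub]
  exact (summable_digits x k).tsum_le_tsum (fun n => val_digit_mul_le x _)
    (summable_two_zpow_sub k)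

/-- The zero digit excludes the all-ones tail, whose value is exactly `2 ^ k`. Strict bounds of this
kind are what the modulus of continuity asks for. -/
theorem value_lt {k j : ℤ} {x : DyadicHalfLine} (hx : ∀ j, k ≤ j → x.digit j = 0)
    (hjk : j < k) (hj : x.digit j = 0) : x.value < 2 ^ k := by
  rw [value_eq_tsum hx, ← tsum_two_zpow_sub]
  refine Summable.tsum_lt_tsum (i := (k - 1 - j).toNat) (fun n => val_digit_mul_le x _) ?_
    (summable_digits x k) (summable_two_zpow_sub k)
  have : k - 1 - ((k - 1 - j).toNat : ℤ) = j := by omega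
  rw [this, hj]
  simp
  positivity

theorem two_zpow_le_value {j : ℤ} {x : DyadicHalfLine} (hj : x.digit j ≠ 0) :
    2 ^ j ≤ x.value := by
  have h1 : x.digit j = 1 := by
    generalize x.digit j = a at hj
    revert a
    decide
  have := (summable_value x).le_tsum j fun i _ => by positivity
  simpa [h1, value, ZMod.val_one] using this

theorem value_nonneg (x : DyadicHalfLine) : 0 ≤ x.value :=
  tsum_nonneg fun _ => by positivity

theorem digit_eq_zero_of_value_lt {k : ℤ} {x : DyadicHalfLine} (hx : x.value < 2 ^ k) :
    ∀ j, k ≤ j → x.digit j = 0 := by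
  intro j hj
  by_contra h
  exact absurd (two_zpow_le_value h)
    (not_le.2 (hx.trans_le (zpow_le_zpow_right₀ one_le_two hj)))

theorem digit_point_eq_zero {m i : ℕ} (hi : i < 2 ^ m) (s : ℕ → Fin 2) :
    ∀ j : ℤ, m ≤ j → (point i s).digit j = 0 := by
  intro j hj
  obtain ⟨n, rfl⟩ := Int.eq_ofNat_of_zero_le (a := j) (by omega)
  have h : i < 2 ^ n := hi.trans_le (Nat.pow_le_pow_right (by norm_num) (by omega))
  rw [digit_point_natCast, Nat.testBit_lt_two_pow h]
  simp

theorem value_point_le {m i : ℕ} (hi : i < 2 ^ m) (s : ℕ → Fin 2) :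
    (point i s).value ≤ 2 ^ m := by
  exact_mod_cast value_le (digit_point_eq_zero hi s)

theorem value_point_lt {m i n : ℕ} (hi : i < 2 ^ m) {s : ℕ → Fin 2} (hn : s n = 0) :
    (point i s).value < 2 ^ m := by
  exact_mod_cast value_lt (j := Int.negSucc n) (digit_point_eq_zero hi s) (by omega) hn

theorem two_pow_le_value_point {M i : ℕ} (hi : 2 ^ M ≤ i) (s : ℕ → Fin 2) :
    2 ^ M ≤ (point i s).value := by
  obtain ⟨n, hn, h⟩ := Nat.exists_ge_and_testBit_of_ge_two_pow hi
  have := two_zpow_le_value (x := point i s) (j := n) (by simp [h])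
  rw [zpow_natCast] at this
  exact (pow_le_pow_right₀ one_le_two hn).trans this

theorem digit_point_zero_eq_zero {r : ℕ} {u : ℕ → Fin 2} (hu : ∀ n < r, u n = 0) :
    ∀ j : ℤ, -r ≤ j → (point 0 u).digit j = 0 := by
  intro j hj
  cases j with
  | ofNat n => exact (digit_point_natCast 0 u n).trans (by simp)
  | negSucc n => exact hu n (by omega)

theorem value_point_zero_le {r : ℕ} {u : ℕ → Fin 2} (hu : ∀ n < r, u n = 0) :
    (point 0 u).value ≤ 2 ^ (-(r : ℤ)) := value_le (digit_point_zero_eq_zero hu)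

theorem value_point_zero_lt {r n : ℕ} {u : ℕ → Fin 2} (hu : ∀ n < r, u n = 0) (hrn : r ≤ n)
    (hn : u n = 0) : (point 0 u).value < 2 ^ (-(r : ℤ)) :=
  value_lt (j := Int.negSucc n) (digit_point_zero_eq_zero hu) (by omega) hn

theorem exists_eq_point_zero_of_value_lt {r : ℕ} {x : DyadicHalfLine}
    (hx : x.value < 2 ^ (-(r : ℤ))) : ∃ u, (∀ n < r, u n = 0) ∧ x = point 0 u := by
  have h := digit_eq_zero_of_value_lt hx
  obtain ⟨i, hi, s, rfl⟩ := exists_eq_point_of_digit_eq_zero (k := 0) (x := x)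
    fun j hj => h j (by omega)
  obtain rfl : i = 0 := by simpa using hi
  exact ⟨s, fun n hn => h (Int.negSucc n) (by omega), rfl⟩

end DyadicHalfLine

/-! ### `W`-continuity in terms of digits -/

theorem agreeUpTo_add_self_right {r : ℕ} {s u : ℕ → Fin 2} (hu : ∀ n < r, u n = 0) :
    AgreeUpTo r (s + u) s := fun n hn => by simp [hu n hn]

theorem sequence_add_add_cancel (s s' : ℕ → Fin 2) : s + (s + s') = s' := by
  funext n
  simp only [Pi.add_apply]
  generalize s n = a
  generalize s' n = b
  revert a b
  decide

open DyadicHalfLine in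
/-- `W`-continuity in terms of binary digits. -/
theorem wContinuous_iff {f : DyadicHalfLine → ℝ} :
    WContinuous f ↔ ∀ i s, ∀ ε > 0, ∃ r, ∀ s', AgreeUpTo r s' s →
      |f (point i s') - f (point i s)| < ε := by
  constructor
  · intro h i s ε hε
    have h1 := (Metric.tendsto_nhds.1 (h (point i s))) ε hε
    rw [eventually_comap] at h1
    obtain ⟨δ, hδ, h2⟩ := Metric.eventually_nhds_iff.1 h1
    obtain ⟨r, hr⟩ := exists_pow_lt_of_lt_one hδ (by norm_num : (1 / 2 : ℝ) < 1)
    refine ⟨r, fun s' hs' => ?_⟩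
    have hu : ∀ n < r, (s + s') n = 0 := fun n hn => by
      rw [Pi.add_apply, hs' n hn]
      generalize s n = a
      revert a
      decide
    have h3 : (point 0 (s + s')).value < δ := by
      refine (value_point_zero_le hu).trans_lt ?_
      simpa using hr
    have h4 := h2 (y := (point 0 (s + s')).value) (by
      rwa [Real.dist_eq, sub_zero, abs_of_nonneg (value_nonneg _)]) _ rfl
    rw [point_add_point, Nat.xor_zero, sequence_add_add_cancel, Real.dist_eq, sub_zero,
      abs_abs] at h4
    exact h4
  · intro h x
    obtain ⟨i, s, rfl⟩ := exists_eq_point x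
    rw [Metric.tendsto_nhds]
    intro ε hε
    obtain ⟨r, hr⟩ := h i s ε hε
    rw [eventually_comap]
    have hpos : (0 : ℝ) < 2 ^ (-(r : ℤ)) := by positivity
    filter_upwards [eventually_lt_nhds hpos] with y hy z hz
    obtain ⟨u, hu, rfl⟩ := exists_eq_point_zero_of_value_lt (x := z) (hz ▸ hy)
    rw [point_add_point, Nat.xor_zero, Real.dist_eq, sub_zero, abs_abs]
    exact hr _ (agreeUpTo_add_self_right hu)

/-! ### Words of digits -/

/-- The sequence that starts with the word `w` and continues with `s`. -/
def prependWord (w : List (Fin 2)) (s : ℕ → Fin 2) : ℕ → Fin 2 := w.foldr consDigit s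

@[simp]
theorem prependWord_cons (d : Fin 2) (w : List (Fin 2)) (s : ℕ → Fin 2) :
    prependWord (d :: w) s = consDigit d (prependWord w s) := rfl

theorem prependWord_append (w w' : List (Fin 2)) (s : ℕ → Fin 2) :
    prependWord (w ++ w') s = prependWord w (prependWord w' s) := List.foldr_append

theorem agreeUpTo_prependWord (w : List (Fin 2)) (s s' : ℕ → Fin 2) :
    AgreeUpTo w.length (prependWord w s) (prependWord w s') := by
  induction w with
  | nil => exact fun n hn => absurd hn (Nat.not_lt_zero n)
  | cons d w ih => exact ih.consDigit d

theorem prependWord_add_length (w : List (Fin 2)) (s : ℕ → Fin 2) (n : ℕ) :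
    prependWord w s (n + w.length) = s n := by
  induction w with
  | nil => rfl
  | cons d w ih => exact ih

/-- The word of the first `r` digits of `s`. -/
def initialWord (s : ℕ → Fin 2) (r : ℕ) : List (Fin 2) := (List.range r).map s

@[simp]
theorem length_initialWord (s : ℕ → Fin 2) (r : ℕ) : (initialWord s r).length = r := by
  simp [initialWord]

theorem initialWord_succ (s : ℕ → Fin 2) (r : ℕ) :
    initialWord s (r + 1) = initialWord s r ++ [s r] := by
  simp [initialWord, List.range_succ]

theorem initialWord_consDigit (d : Fin 2) (s : ℕ → Fin 2) (r : ℕ) :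
    initialWord (consDigit d s) (r + 1) = d :: initialWord s r := by
  simp [initialWord, List.range_succ_eq_map, consDigit, Function.comp_def]

theorem AgreeUpTo.initialWord_eq {r : ℕ} {s s' : ℕ → Fin 2} (h : AgreeUpTo r s s') :
    initialWord s r = initialWord s' r :=
  List.map_congr_left fun n hn => h n (List.mem_range.1 hn)

theorem prependWord_initialWord (s : ℕ → Fin 2) (r : ℕ) :
    prependWord (initialWord s r) (fun n => s (n + r)) = s := by
  induction r generalizing s with
  | zero => rfl
  | succ r ih =>
    conv_lhs => rw [← consDigit_head_tail s, initialWord_consDigit]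
    rw [prependWord_cons, consDigit_head_tail s]
    have : (fun n => s (n + (r + 1))) = fun n => (fun k => s (k + 1)) (n + r) := rfl
    rw [this, ih, consDigit_head_tail]

/-! ### The linear maps of the mask -/

/-- `T_d` as a linear map. -/
noncomputable def maskLinearMap (m : ℕ) (c : ℕ → ℝ) (d : Fin 2) :
    Module.End ℝ (Fin (2 ^ m) → ℝ) := Matrix.toLin' (maskMatrix m c d)

theorem maskMap_apply (m : ℕ) (c : ℕ → ℝ) (d : Fin 2) (x : Fin (2 ^ m) → ℝ) :
    maskMap m c d x = maskLinearMap m c d x := rfl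

/-- The product `T_{d₁} ⋯ T_{dᵣ}` for the word `d₁ … dᵣ`. -/
noncomputable def wordMap (m : ℕ) (c : ℕ → ℝ) (w : List (Fin 2)) :
    Module.End ℝ (Fin (2 ^ m) → ℝ) := (w.map (maskLinearMap m c)).prod

theorem wordMap_cons_apply (m : ℕ) (c : ℕ → ℝ) (d : Fin 2) (w : List (Fin 2))
    (x : Fin (2 ^ m) → ℝ) : wordMap m c (d :: w) x = maskLinearMap m c d (wordMap m c w x) := by
  simp [wordMap]

theorem wordMap_append_apply (m : ℕ) (c : ℕ → ℝ) (w w' : List (Fin 2)) (x : Fin (2 ^ m) → ℝ) :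
    wordMap m c (w ++ w') x = wordMap m c w (wordMap m c w' x) := by
  simp [wordMap]

/-- The extension of a vector by zero. -/
def extendByZero {N : ℕ} (x : Fin N → ℝ) (i : ℕ) : ℝ := if h : i < N then x ⟨i, h⟩ else 0

theorem extendByZero_val {N : ℕ} (x : Fin N → ℝ) (i : Fin N) : extendByZero x i = x i := by
  simp [extendByZero]

theorem extendByZero_of_le {N : ℕ} (x : Fin N → ℝ) {i : ℕ} (h : N ≤ i) : extendByZero x i = 0 :=
  dif_neg (not_lt.2 h)

theorem extendByZero_smul {N : ℕ} (a : ℝ) (x : Fin N → ℝ) (i : ℕ) :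
    extendByZero (a • x) i = a * extendByZero x i := by
  by_cases h : i < N <;> simp [extendByZero, h]

theorem extendByZero_add {N : ℕ} (x y : Fin N → ℝ) (i : ℕ) :
    extendByZero (x + y) i = extendByZero x i + extendByZero y i := by
  by_cases h : i < N <;> simp [extendByZero, h]

theorem extendByZero_sub {N : ℕ} (x y : Fin N → ℝ) (i : ℕ) :
    extendByZero (x - y) i = extendByZero x i - extendByZero y i := by
  by_cases h : i < N <;> simp [extendByZero, h]

/-- Xor with `l < 2 ^ (m + 1)` preserves both `[0, 2 ^ (m + 1))` and its complement. This is why the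
refinement equation respects the support `i < 2 ^ m`. -/
theorem two_mul_add_xor_lt_iff {m i l : ℕ} {d : Fin 2} (hl : l < 2 ^ (m + 1)) :
    (2 * i + d) ^^^ l < 2 ^ (m + 1) ↔ i < 2 ^ m := by
  have hpow : 2 ^ (m + 1) = 2 * 2 ^ m := pow_succ' 2 m
  constructor
  · intro h
    have := Nat.xor_lt_two_pow h hl
    rw [Nat.xor_xor_cancel_right] at this
    omega
  · intro h
    exact Nat.xor_lt_two_pow (by omega) hl

/-- The refinement equation on the level of vectors. -/
theorem extendByZero_maskLinearMap (m : ℕ) (c : ℕ → ℝ) (d : Fin 2) (x : Fin (2 ^ m) → ℝ) (i : ℕ) :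
    extendByZero (maskLinearMap m c d x) i =
      ∑ l ∈ Finset.range (2 ^ (m + 1)), c l * extendByZero x ((2 * i + d) ^^^ l) := by
  have hle : 2 ^ m ≤ 2 ^ (m + 1) := Nat.pow_le_pow_right (by norm_num) (by omega)
  by_cases hi : i < 2 ^ m
  · have h1 : extendByZero (maskLinearMap m c d x) i =
        ∑ j ∈ Finset.range (2 ^ m), c ((2 * i + d) ^^^ j) * extendByZero x j := by
      rw [Finset.sum_range]
      simp only [extendByZero_val]
      simp [extendByZero, hi, maskLinearMap, Matrix.toLin'_apply, Matrix.mulVec, dotProduct,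
        maskMatrix]
    -- Padding with zeros to the range `2 ^ (m + 1)` makes xor with `2 * i + d` an involution of the
    -- index set, which gives the substitution `l = (2 * i + d) ^^^ j`.
    have h2 : ∑ j ∈ Finset.range (2 ^ m), c ((2 * i + d) ^^^ j) * extendByZero x j =
        ∑ j ∈ Finset.range (2 ^ (m + 1)), c ((2 * i + d) ^^^ j) * extendByZero x j := by
      refine Finset.sum_subset (Finset.range_mono hle) fun j _ hj => ?_
      rw [extendByZero_of_le x (by simpa using hj), mul_zero]
    rw [h1, h2]
    refine Finset.sum_nbij' (fun j => (2 * i + d) ^^^ j) (fun j => (2 * i + d) ^^^ j)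
      (fun j hj => ?_) (fun j hj => ?_) (fun j _ => ?_) (fun j _ => ?_) fun j _ => ?_
    · exact Finset.mem_range.2 ((two_mul_add_xor_lt_iff (Finset.mem_range.1 hj)).2 hi)
    · exact Finset.mem_range.2 ((two_mul_add_xor_lt_iff (Finset.mem_range.1 hj)).2 hi)
    · exact Nat.xor_xor_cancel_left _ _
    · exact Nat.xor_xor_cancel_left _ _
    · rw [Nat.xor_xor_cancel_left]
  · rw [extendByZero_of_le _ (not_lt.1 hi)]
    refine (Finset.sum_eq_zero fun l hl => ?_).symm
    rw [extendByZero_of_le, mul_zero]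
    by_contra h
    have := (two_mul_add_xor_lt_iff (m := m) (i := i) (d := d) (Finset.mem_range.1 hl)).not.2 hi
    omega

/-! ### Nilpotency of the mean operator on vectors with zero sum -/

/-- The mean `(T₀ + T₁) / 2`. -/
noncomputable def meanMap (m : ℕ) (c : ℕ → ℝ) : Module.End ℝ (Fin (2 ^ m) → ℝ) :=
  (1 / 2 : ℝ) • (maskLinearMap m c 0 + maskLinearMap m c 1)

theorem sum_range_two_mul (n : ℕ) (f : ℕ → ℝ) :
    ∑ s ∈ Finset.range (2 * n), f s = ∑ s ∈ Finset.range n, (f (2 * s) + f (2 * s + 1)) := by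
  induction n with
  | zero => simp
  | succ n ih =>
    rw [mul_add, mul_one, Finset.sum_range_succ, Finset.sum_range_succ, ih,
      Finset.sum_range_succ]
    ring

theorem two_mul_xor_add (t s l : ℕ) (d : Fin 2) :
    (2 * (t ^^^ s) + d) ^^^ l = (2 * t ^^^ l) ^^^ (2 * s + d) := by
  have h (a : ℕ) : (2 * a + (d : ℕ)) / 2 = a := by omega
  have h' (a : ℕ) : (2 * a + (d : ℕ)).testBit 0 = decide ((d : ℕ) = 1) := by
    rw [Nat.testBit_zero]
    congr 2
    omega
  refine Nat.eq_of_testBit_eq fun n => ?_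
  simp only [Nat.testBit_xor]
  cases n with
  | zero =>
    rw [h', h', Nat.testBit_zero (2 * t), Nat.mul_mod_right]
    cases l.testBit 0 <;> cases decide ((d : ℕ) = 1) <;> rfl
  | succ n =>
    simp only [Nat.testBit_succ, h, Nat.testBit_xor, Nat.mul_div_cancel_left _ two_pos]
    cases t.testBit n <;> cases s.testBit n <;> cases (l / 2).testBit n <;> rfl

/-- All sums of `x` over the dyadic blocks of length `2 ^ k` vanish. -/
def BlockSumsVanish {N : ℕ} (k : ℕ) (x : Fin N → ℝ) : Prop :=
  ∀ t, ∑ s ∈ Finset.range (2 ^ k), extendByZero x (t ^^^ s) = 0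

/-- `T₀` and `T₁` contribute the entries at `2 * s` and `2 * s + 1`. A block sum of length `2 ^ k`
of the mean is therefore a combination, with weights `c l / 2`, of block sums of length `2 ^ (k +
1)` of `x`. -/
theorem BlockSumsVanish.meanMap {m k : ℕ} {c : ℕ → ℝ} {x : Fin (2 ^ m) → ℝ}
    (hx : BlockSumsVanish (k + 1) x) : BlockSumsVanish k (meanMap m c x) := by
  intro t
  have h : ∀ s, extendByZero (_root_.meanMap m c x) (t ^^^ s) =
      ∑ l ∈ Finset.range (2 ^ (m + 1)), (1 / 2 * c l) *
        (extendByZero x ((2 * t ^^^ l) ^^^ (2 * s)) +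
          extendByZero x ((2 * t ^^^ l) ^^^ (2 * s + 1))) := by
    intro s
    have h0 := fun l => two_mul_xor_add t s l 0
    have h1 := fun l => two_mul_xor_add t s l 1
    rw [_root_.meanMap, LinearMap.smul_apply, LinearMap.add_apply, extendByZero_smul,
      extendByZero_add, extendByZero_maskLinearMap, extendByZero_maskLinearMap,
      ← Finset.sum_add_distrib, Finset.mul_sum]
    refine Finset.sum_congr rfl fun l _ => ?_
    rw [h0, h1]
    simp only [Fin.val_zero, Fin.val_one, add_zero]
    ring
  simp only [h]
  rw [Finset.sum_comm]
  refine Finset.sum_eq_zero fun l _ => ?_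
  rw [← Finset.mul_sum, ← sum_range_two_mul _ fun s => extendByZero x ((2 * t ^^^ l) ^^^ s),
    ← pow_succ', hx, mul_zero]

/-- The block of length `2 ^ m` through `t` is either the whole index set, permuted, or disjoint
from it. -/
theorem blockSumsVanish_of_sum_eq_zero {m : ℕ} {x : Fin (2 ^ m) → ℝ} (hx : ∑ i, x i = 0) :
    BlockSumsVanish m x := by
  intro t
  by_cases ht : t < 2 ^ m
  · rw [← hx]
    have : ∑ i, x i = ∑ s ∈ Finset.range (2 ^ m), extendByZero x s := by
      rw [Finset.sum_range]
      simp only [extendByZero_val]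
    rw [this]
    refine Finset.sum_nbij' (fun j => t ^^^ j) (fun j => t ^^^ j)
      (fun j hj => ?_) (fun j hj => ?_) (fun j _ => ?_) (fun j _ => ?_) fun j _ => rfl
    · exact Finset.mem_range.2 (Nat.xor_lt_two_pow ht (Finset.mem_range.1 hj))
    · exact Finset.mem_range.2 (Nat.xor_lt_two_pow ht (Finset.mem_range.1 hj))
    · exact Nat.xor_xor_cancel_left _ _
    · exact Nat.xor_xor_cancel_left _ _
  · refine Finset.sum_eq_zero fun s hs => extendByZero_of_le x ?_
    by_contra h
    have := Nat.xor_lt_two_pow (not_le.1 h) (Finset.mem_range.1 hs)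
    rw [Nat.xor_xor_cancel_right] at this
    exact ht this

theorem BlockSumsVanish.eq_zero {N : ℕ} {x : Fin N → ℝ} (hx : BlockSumsVanish 0 x) : x = 0 := by
  funext i
  have := hx i
  simpa [extendByZero_val] using this

/-- Each application of the mean halves the length of the blocks with vanishing sums; after `m`
steps the blocks are single entries. -/
theorem meanMap_pow_eq_zero {m : ℕ} (c : ℕ → ℝ) {x : Fin (2 ^ m) → ℝ} (hx : ∑ i, x i = 0) :
    (meanMap m c ^ m) x = 0 := by
  suffices h : ∀ k ≤ m, BlockSumsVanish (m - k) ((meanMap m c ^ k) x) by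
    have := h m le_rfl
    rw [Nat.sub_self] at this
    exact this.eq_zero
  intro k
  induction k with
  | zero => exact fun _ => blockSumsVanish_of_sum_eq_zero hx
  | succ k ih =>
    intro hk
    rw [pow_succ', Module.End.mul_apply]
    refine BlockSumsVanish.meanMap ?_
    rw [show m - (k + 1) + 1 = m - k by omega]
    exact ih (by omega)

/-! ### Refinement curves -/

/-- A refinement curve: a uniformly continuous vector function on the Cantor set with
`γ (d, s) = T_d (γ s)`. -/
structure IsRefinementCurve (m : ℕ) (c : ℕ → ℝ) (γ : (ℕ → Fin 2) → Fin (2 ^ m) → ℝ) : Prop where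
  apply_consDigit : ∀ d s, γ (consDigit d s) = maskLinearMap m c d (γ s)
  exists_agreeUpTo : ∀ ε > 0, ∃ r, ∀ s s', AgreeUpTo r s s' → ‖γ s - γ s'‖ < ε

namespace IsRefinementCurve

variable {m : ℕ} {c : ℕ → ℝ} {γ γ' : (ℕ → Fin 2) → Fin (2 ^ m) → ℝ}

theorem apply_prependWord (h : IsRefinementCurve m c γ) (w : List (Fin 2)) (s : ℕ → Fin 2) :
    γ (prependWord w s) = wordMap m c w (γ s) := by
  induction w with
  | nil => rfl
  | cons d w ih => rw [prependWord_cons, h.apply_consDigit, ih, wordMap_cons_apply]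

theorem sub (h : IsRefinementCurve m c γ) (h' : IsRefinementCurve m c γ') :
    IsRefinementCurve m c (γ - γ') where
  apply_consDigit d s := by
    simp only [Pi.sub_apply, h.apply_consDigit, h'.apply_consDigit, map_sub]
  exists_agreeUpTo ε hε := by
    obtain ⟨r, hr⟩ := h.exists_agreeUpTo (ε / 2) (by linarith)
    obtain ⟨r', hr'⟩ := h'.exists_agreeUpTo (ε / 2) (by linarith)
    refine ⟨max r r', fun s s' hs => ?_⟩
    have h1 := hr s s' (hs.mono (le_max_left _ _))
    have h2 := hr' s s' (hs.mono (le_max_right _ _))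
    have h3 : (γ - γ') s - (γ - γ') s' = (γ s - γ s') - (γ' s - γ' s') := by
      simp only [Pi.sub_apply]
      abel
    rw [h3]
    linarith [norm_sub_le (γ s - γ s') (γ' s - γ' s')]

theorem const_smul (h : IsRefinementCurve m c γ) (a : ℝ) : IsRefinementCurve m c (a • γ) where
  apply_consDigit d s := by
    simp only [Pi.smul_apply, h.apply_consDigit, map_smul]
  exists_agreeUpTo ε hε := by
    obtain ⟨r, hr⟩ := h.exists_agreeUpTo (ε / (|a| + 1)) (by positivity)
    refine ⟨r, fun s s' hs => ?_⟩
    rw [Pi.smul_apply, Pi.smul_apply, ← smul_sub, norm_smul, Real.norm_eq_abs]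
    have h1 := hr s s' hs
    rw [lt_div_iff₀ (by positivity)] at h1
    nlinarith [norm_nonneg (γ s - γ s')]

/-- `T_d` maps the curve into itself, so the hull is invariant under the mean `(T₀ + T₁) / 2`, whose
`m`-th power kills the zero-sum vector `γ 0`. -/
theorem zero_mem_convexHull_range (h : IsRefinementCurve m c γ) (h0 : ∑ i, γ 0 i = 0) :
    (0 : Fin (2 ^ m) → ℝ) ∈ convexHull ℝ (Set.range γ) := by
  have hT : ∀ d, ∀ x ∈ convexHull ℝ (Set.range γ),
      maskLinearMap m c d x ∈ convexHull ℝ (Set.range γ) := by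
    intro d x hx
    have h1 := Set.mem_image_of_mem (maskLinearMap m c d) hx
    rw [LinearMap.image_convexHull] at h1
    refine convexHull_mono ?_ h1
    rintro _ ⟨_, ⟨s, rfl⟩, rfl⟩
    exact ⟨consDigit d s, h.apply_consDigit d s⟩
  have hM : ∀ x ∈ convexHull ℝ (Set.range γ), meanMap m c x ∈ convexHull ℝ (Set.range γ) := by
    intro x hx
    have := (convex_convexHull ℝ (Set.range γ)) (hT 0 x hx) (hT 1 x hx)
      (a := 1 / 2) (b := 1 / 2) (by norm_num) (by norm_num) (by norm_num)
    simpa [meanMap] using this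
  rw [← meanMap_pow_eq_zero c h0]
  suffices hk : ∀ k, (meanMap m c ^ k) (γ 0) ∈ convexHull ℝ (Set.range γ) from hk m
  intro k
  induction k with
  | zero => exact subset_convexHull ℝ _ ⟨0, rfl⟩
  | succ k ih =>
    rw [pow_succ', Module.End.mul_apply]
    exact hM _ ih

/-- A refinement curve is determined by the sum of the coordinates of its initial point. -/
theorem eq_zero (h : IsRefinementCurve m c γ) (h0 : ∑ i, γ 0 i = 0) (s : ℕ → Fin 2) :
    γ s = 0 := by
  refine norm_eq_zero.1 (le_antisymm (le_of_forall_pos_le_add fun ε hε => ?_) (norm_nonneg _))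
  obtain ⟨r, hr⟩ := h.exists_agreeUpTo ε hε
  -- `T_w 0 = 0` keeps `0` in the hull of `T_w (range γ)`. With `w` the first `r` digits of `s`,
  -- this hull lies within `ε` of `γ s`.
  have h1 := Set.mem_image_of_mem (wordMap m c (initialWord s r)) (h.zero_mem_convexHull_range h0)
  rw [LinearMap.image_convexHull, map_zero] at h1
  have h2 : convexHull ℝ (wordMap m c (initialWord s r) '' Set.range γ) ⊆
      Metric.closedBall (γ s) ε := by
    refine convexHull_min ?_ (convex_closedBall _ _)
    rintro _ ⟨_, ⟨u, rfl⟩, rfl⟩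
    rw [← h.apply_prependWord, mem_closedBall_iff_norm]
    refine (hr _ _ ?_).le
    conv_rhs => rw [← prependWord_initialWord s r]
    have := agreeUpTo_prependWord (initialWord s r) u fun n => s (n + r)
    rwa [length_initialWord] at this
  have h3 := h2 h1
  rw [mem_closedBall_iff_norm, zero_sub, norm_neg] at h3
  linarith

theorem eq_of_sum_eq (h : IsRefinementCurve m c γ) (h' : IsRefinementCurve m c γ')
    (h0 : ∑ i, γ 0 i = ∑ i, γ' 0 i) : γ = γ' := by
  funext s
  refine sub_eq_zero.1 ((h.sub h').eq_zero ?_ s)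
  simp [Finset.sum_sub_distrib, h0]

/-- Up to an error `1`, the curve takes only the values at the finitely many words of length `r`
continued by zeros. -/
theorem bounded (h : IsRefinementCurve m c γ) : ∃ K, 0 ≤ K ∧ ∀ s, ‖γ s‖ ≤ K := by
  obtain ⟨r, hr⟩ := h.exists_agreeUpTo 1 one_pos
  obtain ⟨K, hK⟩ := (Set.finite_range fun d : Fin r → Fin 2 =>
    ‖γ (prependWord (List.ofFn d) 0)‖).bddAbove
  have hK' : ∀ s, ‖γ s‖ ≤ K + 1 := fun s => by
    have h1 := hr s (prependWord (initialWord s r) 0) (by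
      have := agreeUpTo_prependWord (initialWord s r) (fun n => s (n + r)) 0
      rwa [length_initialWord, prependWord_initialWord] at this)
    have h2 : ‖γ (prependWord (initialWord s r) 0)‖ ≤ K := hK ⟨fun i => s i, by
      simp only [initialWord, List.ofFn_eq_map, ← List.map_coe_finRange_eq_range, List.map_map,
        Function.comp_def]⟩
    have h3 := norm_sub_norm_le (γ s) (γ (prependWord (initialWord s r) 0))
    linarith
  exact ⟨K + 1, (norm_nonneg _).trans (hK' 0), hK'⟩

end IsRefinementCurve

/-! ### Bounds for the joint spectral radius -/

section JointSpectralRadiusBounds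

variable {E : Type*} [NormedAddCommGroup E] [NormedSpace ℝ E]

theorem norm_map_prod_le_maxProductNorm (A : Fin 2 → E →L[ℝ] E) (w : List (Fin 2)) :
    ‖(w.map A).prod‖ ≤ maxProductNorm A w.length := by
  have h := le_maxProductNorm A w.length w.get
  have h1 : (List.ofFn fun i => A (w.get i)) = w.map A := by
    conv_rhs => rw [← List.ofFn_get w, List.map_ofFn]
    rfl
  rwa [h1] at h

theorem jointSpectralRadius_nonneg (A : Fin 2 → E →L[ℝ] E) : 0 ≤ jointSpectralRadius A :=
  ge_of_tendsto' (tendsto_jointSpectralMax A) fun r => by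
    rw [jointSpectralMax_eq]
    exact Real.rpow_nonneg (maxProductNorm_nonneg A r) _

theorem exists_maxProductNorm_le_of_jointSpectralRadius_lt (A : Fin 2 → E →L[ℝ] E) {q : ℝ}
    (hq : jointSpectralRadius A < q) : ∃ C, 0 ≤ C ∧ ∀ r, maxProductNorm A r ≤ C * q ^ r := by
  have hq0 : 0 < q := (jointSpectralRadius_nonneg A).trans_lt hq
  obtain ⟨R, hR⟩ := eventually_atTop.1 ((tendsto_jointSpectralMax A).eventually_lt_const hq)
  have hsum : ∀ r, 0 ≤ maxProductNorm A r / q ^ r := fun r =>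
    div_nonneg (maxProductNorm_nonneg A r) (by positivity)
  -- Beyond `R` the constant `1` suffices; the sum absorbs the finitely many earlier lengths.
  have hS : 0 ≤ ∑ r ∈ Finset.range (R + 1), maxProductNorm A r / q ^ r :=
    Finset.sum_nonneg fun r _ => hsum r
  refine ⟨1 + ∑ r ∈ Finset.range (R + 1), maxProductNorm A r / q ^ r, by linarith, fun r => ?_⟩
  rw [← div_le_iff₀ (by positivity)]
  by_cases hr : r < R + 1
  · have := Finset.single_le_sum (fun r _ => hsum r) (Finset.mem_range.2 hr)
    linarith
  · have hr0 : (r : ℝ) ≠ 0 := by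
      have : r ≠ 0 := by omega
      exact_mod_cast this
    have h1 := hR r (by omega)
    rw [jointSpectralMax_eq] at h1
    have h2 : maxProductNorm A r ≤ q ^ r := by
      have h3 := Real.rpow_le_rpow (Real.rpow_nonneg (maxProductNorm_nonneg A r) _) h1.le
        (Nat.cast_nonneg r)
      rwa [← Real.rpow_mul (maxProductNorm_nonneg A r), one_div_mul_cancel hr0, Real.rpow_one,
        Real.rpow_natCast] at h3
    have h3 : maxProductNorm A r / q ^ r ≤ 1 := (div_le_one₀ (by positivity)).2 h2
    linarith

theorem jointSpectralRadius_le_of_maxProductNorm_le (A : Fin 2 → E →L[ℝ] E) {q C : ℝ}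
    (hq : 0 < q) (h : ∀ r, maxProductNorm A r ≤ C * q ^ r) : jointSpectralRadius A ≤ q := by
  -- A positive base is needed for its `1 / r`-th power to tend to `1`.
  have hC : 0 < max C 1 := by positivity
  have h1 : Tendsto (fun r : ℕ => max C 1 ^ (1 / (r : ℝ)) * q) atTop (𝓝 q) := by
    have h2 : Tendsto (fun r : ℕ => max C 1 ^ (1 / (r : ℝ))) atTop (𝓝 (max C 1 ^ (0 : ℝ))) :=
      (Real.continuousAt_const_rpow hC.ne').tendsto.comp tendsto_one_div_atTop_nhds_zero_nat
    simpa using h2.mul_const q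
  refine le_of_tendsto_of_tendsto (tendsto_jointSpectralMax A) h1 ?_
  filter_upwards [eventually_gt_atTop 0] with r hr
  have hr0 : (r : ℝ) ≠ 0 := by
    exact_mod_cast hr.ne'
  rw [jointSpectralMax_eq]
  calc maxProductNorm A r ^ (1 / (r : ℝ)) ≤ (max C 1 * q ^ r) ^ (1 / (r : ℝ)) := by
        refine Real.rpow_le_rpow (maxProductNorm_nonneg A r) ((h r).trans ?_) (by positivity)
        gcongr
        exact le_max_left _ _
    _ = max C 1 ^ (1 / (r : ℝ)) * q := by
        rw [Real.mul_rpow hC.le (by positivity), ← Real.rpow_natCast, ← Real.rpow_mul hq.le,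
          mul_one_div_cancel hr0, Real.rpow_one]

theorem maxProductNorm_mul_le (A : Fin 2 → E →L[ℝ] E) (r k : ℕ) :
    maxProductNorm A (r * (k + 1)) ≤ maxProductNorm A r ^ (k + 1) := by
  induction k with
  | zero => simp
  | succ k ih =>
    rw [mul_add, mul_one, pow_succ]
    exact (maxProductNorm_add A _ _).trans
      (mul_le_mul_of_nonneg_right ih (maxProductNorm_nonneg A r))

/-- Along the multiples of `r`, submultiplicativity bounds the defining sequence by `maxProductNorm
A r ^ (1 / r)`. -/
theorem jointSpectralRadius_lt_one_of_maxProductNorm_lt_one (A : Fin 2 → E →L[ℝ] E) {r : ℕ}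
    (hr : 0 < r) (h : maxProductNorm A r < 1) : jointSpectralRadius A < 1 := by
  have hsub : Tendsto (fun k : ℕ => r * (k + 1)) atTop atTop :=
    tendsto_atTop_mono (fun k => (Nat.le_succ k).trans (Nat.le_mul_of_pos_left _ hr)) tendsto_id
  have hle : jointSpectralRadius A ≤ maxProductNorm A r ^ (1 / (r : ℝ)) := by
    refine le_of_tendsto' ((tendsto_jointSpectralMax A).comp hsub) fun k => ?_
    have hr0 : (r : ℝ) ≠ 0 := by
      exact_mod_cast hr.ne'
    have hk : (k : ℝ) + 1 ≠ 0 := by positivity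
    rw [Function.comp_apply, jointSpectralMax_eq]
    refine (Real.rpow_le_rpow (maxProductNorm_nonneg A _) (maxProductNorm_mul_le A r k)
      (by positivity)).trans_eq ?_
    rw [← Real.rpow_natCast, ← Real.rpow_mul (maxProductNorm_nonneg A r)]
    congr 1
    push_cast
    field_simp
  refine hle.trans_lt (Real.rpow_lt_one (maxProductNorm_nonneg A r) h (by positivity))

end JointSpectralRadiusBounds

/-! ### The direction of the minimal subspace -/

/-- The linear part of `A_d`. -/
noncomputable def restrictedLinearPart (m : ℕ) (c : ℕ → ℝ) (v : Fin (2 ^ m) → ℝ) (d : Fin 2) :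
    (minimalSubspace m c v).direction →L[ℝ] (minimalSubspace m c v).direction :=
  LinearMap.toContinuousLinearMap (restrictedOperator m c v d).linear

theorem restrictedJSR_eq (m : ℕ) (c : ℕ → ℝ) (v : Fin (2 ^ m) → ℝ) :
    restrictedJSR m c v = jointSpectralRadius (restrictedLinearPart m c v) := rfl

theorem coe_restrictedLinearPart (m : ℕ) (c : ℕ → ℝ) (v : Fin (2 ^ m) → ℝ) (d : Fin 2)
    (u : (minimalSubspace m c v).direction) :
    (restrictedLinearPart m c v d u : Fin (2 ^ m) → ℝ) = maskLinearMap m c d u := rfl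

theorem coe_map_restrictedLinearPart_prod (m : ℕ) (c : ℕ → ℝ) (v : Fin (2 ^ m) → ℝ)
    (w : List (Fin 2)) (u : (minimalSubspace m c v).direction) :
    ((w.map (restrictedLinearPart m c v)).prod u : Fin (2 ^ m) → ℝ) = wordMap m c w u := by
  induction w with
  | nil => rfl
  | cons d w ih =>
    rw [List.map_cons, List.prod_cons, mul_apply_eq_comp, coe_restrictedLinearPart,
      ih, wordMap_cons_apply]

theorem norm_wordMap_le (m : ℕ) (c : ℕ → ℝ) (v : Fin (2 ^ m) → ℝ) (w : List (Fin 2))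
    {u : Fin (2 ^ m) → ℝ} (hu : u ∈ (minimalSubspace m c v).direction) :
    ‖wordMap m c w u‖ ≤ maxProductNorm (restrictedLinearPart m c v) w.length * ‖u‖ := by
  have h := ((w.map (restrictedLinearPart m c v)).prod).le_opNorm ⟨u, hu⟩
  have h1 : ‖(w.map (restrictedLinearPart m c v)).prod ⟨u, hu⟩‖ = ‖wordMap m c w u‖ := by
    rw [← coe_map_restrictedLinearPart_prod m c v w ⟨u, hu⟩]
    rfl
  rw [h1] at h
  exact h.trans (mul_le_mul_of_nonneg_right (norm_map_prod_le_maxProductNorm _ w) (norm_nonneg _))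

theorem wordMap_mem_minimalSubspace (m : ℕ) (c : ℕ → ℝ) (v : Fin (2 ^ m) → ℝ)
    (w : List (Fin 2)) : wordMap m c w v ∈ minimalSubspace m c v := by
  induction w with
  | nil => exact mem_minimalSubspace m c v
  | cons d w ih =>
    rw [wordMap_cons_apply, ← maskMap_apply]
    exact map_minimalSubspace_le m c v d (AffineSubspace.mem_map_of_mem _ ih)

theorem wordMap_sub_mem_direction (m : ℕ) (c : ℕ → ℝ) (v : Fin (2 ^ m) → ℝ)
    (w : List (Fin 2)) : wordMap m c w v - v ∈ (minimalSubspace m c v).direction :=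
  AffineSubspace.vsub_mem_direction (wordMap_mem_minimalSubspace m c v w)
    (mem_minimalSubspace m c v)

/-- The affine span of the orbit of `v` contains `v` and is invariant, so it competes in the
infimum. -/
theorem minimalSubspace_le_affineSpan (m : ℕ) (c : ℕ → ℝ) (v : Fin (2 ^ m) → ℝ) :
    minimalSubspace m c v ≤ affineSpan ℝ (Set.range fun w => wordMap m c w v) := by
  refine sInf_le ⟨subset_affineSpan ℝ _ ⟨[], rfl⟩, fun d => ?_⟩
  rw [AffineSubspace.map_span]
  refine affineSpan_mono ℝ ?_
  rintro _ ⟨_, ⟨w, rfl⟩, rfl⟩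
  exact ⟨d :: w, wordMap_cons_apply m c d w v⟩

theorem span_wordMap_sub_eq_top (m : ℕ) (c : ℕ → ℝ) (v : Fin (2 ^ m) → ℝ) :
    Submodule.span ℝ (Set.range fun w : List (Fin 2) =>
      (⟨wordMap m c w v - v, wordMap_sub_mem_direction m c v w⟩ :
        (minimalSubspace m c v).direction)) = ⊤ := by
  rw [eq_top_iff]
  rintro ⟨u, hu⟩ -
  have h1 := AffineSubspace.direction_le (minimalSubspace_le_affineSpan m c v) hu
  rw [direction_affineSpan, vectorSpan_eq_span_vsub_set_right ℝ
    (show v ∈ Set.range fun w => wordMap m c w v from ⟨[], rfl⟩)] at h1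
  have h2 : (fun x => x -ᵥ v) '' (Set.range fun w => wordMap m c w v) =
      (minimalSubspace m c v).direction.subtype '' (Set.range fun w : List (Fin 2) =>
        ⟨wordMap m c w v - v, wordMap_sub_mem_direction m c v w⟩) := by
    rw [← Set.range_comp, ← Set.range_comp]
    rfl
  rw [h2, Submodule.span_image, Submodule.mem_map] at h1
  obtain ⟨y, hy, hyu⟩ := h1
  have : y = ⟨u, hu⟩ := Subtype.ext hyu
  rwa [this] at hy

/-- The norms of the products are controlled by their action on the differences `T_w v - v`. -/
theorem exists_maxProductNorm_le (m : ℕ) (c : ℕ → ℝ) (v : Fin (2 ^ m) → ℝ) :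
    ∃ C > 0, ∀ (r : ℕ) (b : ℝ), 0 ≤ b →
      (∀ w w' : List (Fin 2), w.length = r → ‖wordMap m c w (wordMap m c w' v - v)‖ ≤ b) →
      maxProductNorm (restrictedLinearPart m c v) r ≤ C * b := by
  have hs := (span_wordMap_sub_eq_top m c v).ge
  -- A basis is chosen among the differences `T_w' v - v`. Bounds on these finitely many vectors
  -- control the operator norm, with a constant that does not depend on the word.
  set B := Module.Basis.ofSpan hs
  have : Finite _ := Module.Finite.finite_basis B
  obtain ⟨C, hC, h⟩ := B.exists_opNorm_le (F := (minimalSubspace m c v).direction)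
  refine ⟨C, hC, fun r b hb hw => ciSup_le fun d => h hb fun i => ?_⟩
  obtain ⟨w', hw'⟩ := Module.Basis.ofSpan_subset hs ⟨i, rfl⟩
  have h1 : (List.ofFn fun i => restrictedLinearPart m c v (d i)) =
      (List.ofFn d).map (restrictedLinearPart m c v) := by
    rw [List.map_ofFn]
    rfl
  have h2 := hw (List.ofFn d) w' List.length_ofFn
  rw [h1, Submodule.coe_norm, coe_map_restrictedLinearPart_prod]
  have h3 : ((B i : (minimalSubspace m c v).direction) : Fin (2 ^ m) → ℝ) =
      wordMap m c w' v - v := (congrArg Subtype.val hw').symm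
  rwa [h3]

/-! ### Refinement curves and the joint spectral radius -/

namespace IsRefinementCurve

variable {m : ℕ} {c : ℕ → ℝ} {γ : (ℕ → Fin 2) → Fin (2 ^ m) → ℝ}

theorem wordMap_wordMap_sub (h : IsRefinementCurve m c γ) (w w' : List (Fin 2)) :
    wordMap m c w (wordMap m c w' (γ 0) - γ 0) =
      γ (prependWord w (prependWord w' 0)) - γ (prependWord w 0) := by
  rw [map_sub, h.apply_prependWord, h.apply_prependWord, h.apply_prependWord]

theorem restrictedJSR_lt_one (h : IsRefinementCurve m c γ) : restrictedJSR m c (γ 0) < 1 := by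
  obtain ⟨C, hC, hb⟩ := exists_maxProductNorm_le m c (γ 0)
  obtain ⟨r, hr⟩ := h.exists_agreeUpTo (1 / (2 * C)) (by positivity)
  rw [restrictedJSR_eq]
  refine jointSpectralRadius_lt_one_of_maxProductNorm_lt_one _ (Nat.succ_pos r) ?_
  -- The oscillation bound `1 / (2 * C)` makes the product norm at most `1 / 2`; `r + 1` is used so
  -- that the length is positive.
  refine (hb (r + 1) (1 / (2 * C)) (by positivity) fun w w' hw => ?_).trans_lt ?_
  · rw [h.wordMap_wordMap_sub]
    refine (hr _ _ ?_).le
    have := agreeUpTo_prependWord w (prependWord w' 0) 0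
    exact this.mono (by omega)
  · rw [mul_one_div, div_lt_one (by positivity)]
    linarith

theorem exists_norm_sub_le (h : IsRefinementCurve m c γ) {q : ℝ}
    (hq : restrictedJSR m c (γ 0) < q) :
    ∃ C, 0 ≤ C ∧ ∀ r s s', AgreeUpTo r s s' → ‖γ s - γ s'‖ ≤ C * q ^ r := by
  have hq0 : 0 < q := (jointSpectralRadius_nonneg _).trans_lt hq
  obtain ⟨C, hC, hA⟩ := exists_maxProductNorm_le_of_jointSpectralRadius_lt _ hq
  obtain ⟨K, hK0, hK⟩ := h.bounded
  -- Both sequences will be compared with their common prefix followed by zeros. Cutting the tail of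
  -- `s` after `p` more digits, at a cost of `ε`, makes the difference `T_w` of a vector in the
  -- direction of `V`, where the product bound applies.
  have hstep : ∀ r s, ‖γ s - γ (prependWord (initialWord s r) 0)‖ ≤ C * (2 * K) * q ^ r := by
    intro r s
    refine le_of_forall_pos_le_add fun ε hε => ?_
    obtain ⟨p, hp⟩ := h.exists_agreeUpTo ε hε
    set s₁ : ℕ → Fin 2 := fun n => s (n + r)
    have hs : s = prependWord (initialWord s r) s₁ := (prependWord_initialWord s r).symm
    have h1 : ‖γ s - γ (prependWord (initialWord s r) (prependWord (initialWord s₁ p) 0))‖ < ε := by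
      refine hp _ _ ?_
      conv_lhs => rw [hs, ← prependWord_initialWord s₁ p]
      rw [← prependWord_append, ← prependWord_append]
      exact (agreeUpTo_prependWord _ _ _).mono (by simp)
    have h2 : ‖γ (prependWord (initialWord s r) (prependWord (initialWord s₁ p) 0)) -
        γ (prependWord (initialWord s r) 0)‖ ≤ C * (2 * K) * q ^ r := by
      rw [← h.wordMap_wordMap_sub]
      refine (norm_wordMap_le m c (γ 0) _ (wordMap_sub_mem_direction m c (γ 0) _)).trans ?_
      rw [length_initialWord, ← h.apply_prependWord]
      have h3 : ‖γ (prependWord (initialWord s₁ p) 0) - γ 0‖ ≤ 2 * K := by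
        linarith [norm_sub_le (γ (prependWord (initialWord s₁ p) 0)) (γ 0), hK 0,
          hK (prependWord (initialWord s₁ p) 0)]
      calc _ ≤ C * q ^ r * (2 * K) := by
            refine mul_le_mul (hA r) h3 (norm_nonneg _) (by positivity)
        _ = _ := by ring
    linarith [norm_sub_le_norm_sub_add_norm_sub (γ s)
      (γ (prependWord (initialWord s r) (prependWord (initialWord s₁ p) 0)))
      (γ (prependWord (initialWord s r) 0))]
  refine ⟨2 * (C * (2 * K)), by positivity, fun r s s' hs => ?_⟩
  have h1 := hstep r s
  have h2 := hstep r s'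
  rw [← hs.initialWord_eq] at h2
  rw [norm_sub_rev] at h2
  linarith [norm_sub_le_norm_sub_add_norm_sub (γ s) (γ (prependWord (initialWord s r) 0)) (γ s')]

end IsRefinementCurve

/-- `γ s` is the limit of `T_{s₀} ⋯ T_{s_{r-1}} v`. Consecutive terms differ by a product of length
`r` applied to some `T_d v - v` in the direction of `V`, hence by `O(q ^ r)` with `q < 1`. -/
theorem exists_isRefinementCurve {m : ℕ} {c : ℕ → ℝ} {v : Fin (2 ^ m) → ℝ}
    (hv : maskLinearMap m c 0 v = v) (hρ : restrictedJSR m c v < 1) :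
    ∃ γ, IsRefinementCurve m c γ ∧ γ 0 = v := by
  obtain ⟨q, hρq, hq1⟩ := exists_between hρ
  have hq0 : 0 < q := (jointSpectralRadius_nonneg _).trans_lt hρq
  obtain ⟨C, hC, hA⟩ := exists_maxProductNorm_le_of_jointSpectralRadius_lt _ hρq
  obtain ⟨K, hK⟩ := (Set.finite_range fun d : Fin 2 => ‖wordMap m c [d] v - v‖).bddAbove
  have hK0 : 0 ≤ K := (norm_nonneg _).trans (hK ⟨0, rfl⟩)
  have hdist : ∀ s r, dist (wordMap m c (initialWord s r) v)
      (wordMap m c (initialWord s (r + 1)) v) ≤ C * K * q ^ r := by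
    intro s r
    rw [dist_comm, dist_eq_norm, initialWord_succ, wordMap_append_apply, ← map_sub]
    refine (norm_wordMap_le m c v _ (wordMap_sub_mem_direction m c v _)).trans ?_
    rw [length_initialWord]
    calc _ ≤ C * q ^ r * K := by
          refine mul_le_mul (hA r) (hK ⟨s r, rfl⟩) (norm_nonneg _) (by positivity)
      _ = _ := by ring
  have hlim : ∀ s, ∃ x, Tendsto (fun r => wordMap m c (initialWord s r) v) atTop (𝓝 x) :=
    fun s => cauchySeq_tendsto_of_complete (cauchySeq_of_le_geometric q _ hq1 (hdist s))
  choose γ hγ using hlim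
  have hbound : ∀ s r, dist (wordMap m c (initialWord s r) v) (γ s) ≤ C * K * q ^ r / (1 - q) :=
    fun s => dist_le_of_le_geometric_of_tendsto q _ hq1 (hdist s) (hγ s)
  refine ⟨γ, ⟨fun d s => ?_, fun ε hε => ?_⟩, ?_⟩
  · have h1 := (tendsto_add_atTop_iff_nat 1).2 (hγ (consDigit d s))
    simp only [initialWord_consDigit, wordMap_cons_apply] at h1
    exact tendsto_nhds_unique h1
      (((maskLinearMap m c d).continuous_of_finiteDimensional.tendsto _).comp (hγ s))
  · have h1 : Tendsto (fun r => C * K * q ^ r / (1 - q)) atTop (𝓝 (C * K * 0 / (1 - q))) :=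
      ((tendsto_pow_atTop_nhds_zero_of_lt_one hq0.le hq1).const_mul _).div_const _
    rw [mul_zero, zero_div] at h1
    obtain ⟨r, hr⟩ := (h1.eventually_lt_const (half_pos hε)).exists
    refine ⟨r, fun s s' hs => ?_⟩
    have h2 := hbound s r
    have h3 := hbound s' r
    rw [← hs.initialWord_eq] at h3
    rw [← dist_eq_norm]
    linarith [dist_triangle_left (γ s) (γ s') (wordMap m c (initialWord s r) v)]
  -- All digits of the zero sequence select `T₀`, which fixes `v`, so the approximating sequence is
  -- constant.
  · refine tendsto_nhds_unique (hγ 0) (tendsto_const_nhds.congr fun r => ?_)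
    induction r with
    | zero => rfl
    | succ r ih =>
      have h0 : (0 : ℕ → Fin 2) = consDigit 0 0 := (consDigit_head_tail 0).symm
      rw [h0, initialWord_consDigit, wordMap_cons_apply, ← ih, hv]

/-! ### Continuous solutions and refinement curves -/

/-- Heine–Cantor: finitely many cylinders of continuity cover the compact Cantor set. -/
theorem exists_agreeUpTo_uniform {F : Type*} [SeminormedAddCommGroup F] {f : (ℕ → Fin 2) → F}
    (hf : ∀ s, ∀ ε > 0, ∃ r, ∀ s', AgreeUpTo r s' s → ‖f s' - f s‖ < ε) {ε : ℝ} (hε : 0 < ε) :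
    ∃ r, ∀ s s', AgreeUpTo r s s' → ‖f s - f s'‖ < ε := by
  choose r hr using fun s => hf s (ε / 2) (half_pos hε)
  obtain ⟨t, -, ht⟩ := isCompact_univ.elim_nhds_subcover
    (fun s : ℕ → Fin 2 => PiNat.cylinder s (r s)) fun s _ =>
      (PiNat.isOpen_cylinder _ s (r s)).mem_nhds (PiNat.self_mem_cylinder s (r s))
  refine ⟨t.sup r, fun s s' hs => ?_⟩
  obtain ⟨u, hu, hsu⟩ := Set.mem_iUnion₂.1 (ht (Set.mem_univ s))
  have h1 : AgreeUpTo (r u) s u := fun n hn => hsu n hn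
  have h2 : AgreeUpTo (r u) s' u := (hs.mono (Finset.le_sup hu)).symm.trans h1
  have h3 := hr u s h1
  have h4 := hr u s' h2
  rw [norm_sub_rev] at h4
  linarith [norm_sub_le_norm_sub_add_norm_sub (f s) (f u) (f s')]

open DyadicHalfLine

namespace IsContinuousRefinable

variable {m : ℕ} {c : ℕ → ℝ} {φ : DyadicHalfLine → ℝ}

theorem apply_point_consDigit (h : IsContinuousRefinable m c φ) (i : ℕ) (d : Fin 2)
    (s : ℕ → Fin 2) : φ (point i (consDigit d s)) =
      ∑ k ∈ Finset.range (2 ^ (m + 1)), c k * φ (point ((2 * i + d) ^^^ k) s) := by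
  rw [h.refinement]
  simp only [double_point_sub_ofNat]

/-- A continuous solution is supported on the points below `2 ^ m`. -/
theorem apply_point_eq_zero (h : IsContinuousRefinable m c φ) {i : ℕ} (hi : 2 ^ m ≤ i)
    (s : ℕ → Fin 2) : φ (point i s) = 0 := by
  obtain ⟨R, hR⟩ := h.compactSupport
  obtain ⟨M, hM⟩ := pow_unbounded_of_one_lt R (one_lt_two (α := ℝ))
  -- Each use of the equation lowers by one the exponent beyond which `φ` vanishes, from `m + M`,
  -- given by compact support, down to `m`.
  suffices hk : ∀ k, ∀ i, 2 ^ (m + (M - k)) ≤ i → ∀ s, φ (point i s) = 0 from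
    hk M i (by simpa using hi) s
  intro k
  induction k with
  | zero =>
    intro i hi s
    refine hR _ (hM.trans_le ((pow_le_pow_right₀ one_le_two ?_).trans (two_pow_le_value_point hi s)))
    omega
  | succ k ih =>
    intro i hi s
    by_cases hkM : M ≤ k
    · exact ih i (by rwa [show M - k = M - (k + 1) by omega]) s
    · rw [← consDigit_head_tail s, h.apply_point_consDigit]
      refine Finset.sum_eq_zero fun l hl => ?_
      rw [ih, mul_zero]
      rw [show m + (M - k) = m + (M - (k + 1)) + 1 by omega]
      by_contra hlt
      have hl' : l < 2 ^ (m + (M - (k + 1)) + 1) := (Finset.mem_range.1 hl).trans_le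
        (Nat.pow_le_pow_right (by norm_num) (by omega))
      exact absurd ((two_mul_add_xor_lt_iff hl').1 (not_le.1 hlt)) (not_lt.2 hi)

theorem exists_isRefinementCurve (h : IsContinuousRefinable m c φ) :
    ∃ γ, IsRefinementCurve m c γ ∧ ∀ i s, φ (point i s) = extendByZero (γ s) i := by
  have hext : ∀ i s, φ (point i s) =
      extendByZero (fun j : Fin (2 ^ m) => φ (point j s)) i := by
    intro i s
    by_cases hi : i < 2 ^ m
    · simp [extendByZero, hi]
    · rw [extendByZero_of_le _ (not_lt.1 hi), h.apply_point_eq_zero (not_lt.1 hi)]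
  refine ⟨fun s j => φ (point j s), ⟨fun d s => ?_, fun ε hε => ?_⟩, hext⟩
  · funext i
    rw [← extendByZero_val (maskLinearMap m c d _) i, extendByZero_maskLinearMap,
      h.apply_point_consDigit]
    exact Finset.sum_congr rfl fun l _ => by rw [hext]
  · refine exists_agreeUpTo_uniform (fun s ε hε => ?_) hε
    choose r hr using fun i : Fin (2 ^ m) => wContinuous_iff.1 h.wContinuous i s ε hε
    refine ⟨Finset.univ.sup r, fun s' hs' => ?_⟩
    rw [pi_norm_lt_iff hε]
    exact fun i => hr i s' (hs'.mono (Finset.le_sup (Finset.mem_univ i)))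

end IsContinuousRefinable

theorem IsRefinementCurve.exists_isContinuousRefinable {m : ℕ} {c : ℕ → ℝ}
    {γ : (ℕ → Fin 2) → Fin (2 ^ m) → ℝ} (h : IsRefinementCurve m c γ) (h0 : γ 0 ≠ 0) :
    ∃ φ, IsContinuousRefinable m c φ := by
  choose i s his using exists_eq_point
  set φ : DyadicHalfLine → ℝ := fun x => extendByZero (γ (s x)) (i x)
  have hφ : ∀ j t, φ (point j t) = extendByZero (γ t) j := fun j t => by
    obtain ⟨h1, h2⟩ := point_injective (his (point j t))
    simp only [φ, ← h1, ← h2]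
  refine ⟨φ, ⟨?_, ⟨2 ^ m, fun x hx => ?_⟩, fun hzero => h0 ?_, fun t => ?_⟩⟩
  · rw [wContinuous_iff]
    intro j t ε hε
    obtain ⟨r, hr⟩ := h.exists_agreeUpTo ε hε
    refine ⟨r, fun t' ht' => ?_⟩
    rw [hφ, hφ, ← extendByZero_sub]
    by_cases hj : j < 2 ^ m
    · simp only [extendByZero, hj, dite_true]
      exact (norm_le_pi_norm _ _).trans_lt (hr t' t ht')
    · rwa [extendByZero_of_le _ (not_lt.1 hj), abs_zero]
  · obtain ⟨j, t, rfl⟩ := exists_eq_point x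
    rw [hφ]
    refine extendByZero_of_le _ ?_
    by_contra hj
    exact absurd (value_point_le (not_le.1 hj) t) (not_le.2 hx)
  · funext j
    rw [← extendByZero_val (γ 0) j, ← hφ, hzero]
    rfl
  · obtain ⟨j, t, rfl⟩ := exists_eq_point t
    rw [hφ, ← consDigit_head_tail t, h.apply_consDigit, extendByZero_maskLinearMap]
    simp only [double_point_sub_ofNat, hφ]

/-- The sum of the coordinates of the initial point of the curve of a continuous solution is not
zero. -/
theorem IsContinuousRefinable.exists_normalized_curve {m : ℕ} {c : ℕ → ℝ}
    {φ : DyadicHalfLine → ℝ} (h : IsContinuousRefinable m c φ) :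
    ∃ (σ : ℝ) (γ : (ℕ → Fin 2) → Fin (2 ^ m) → ℝ), σ ≠ 0 ∧ IsRefinementCurve m c γ ∧
      IsNormalizedEigenvector m c (γ 0) ∧ ∀ i s, φ (point i s) = σ * extendByZero (γ s) i := by
  obtain ⟨γ, hγ, hφ⟩ := h.exists_isRefinementCurve
  have hσ : ∑ i, γ 0 i ≠ 0 := by
    intro h0
    refine h.ne_zero (funext fun x => ?_)
    obtain ⟨i, s, rfl⟩ := exists_eq_point x
    rw [hφ, hγ.eq_zero h0]
    by_cases hi : i < 2 ^ m <;> simp [extendByZero, hi]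
  have hγ' := hγ.const_smul (∑ i, γ 0 i)⁻¹
  refine ⟨∑ i, γ 0 i, _, hσ, hγ', ⟨?_, ?_⟩, fun i s => ?_⟩
  · have h1 := hγ'.apply_consDigit 0 0
    rw [show consDigit 0 0 = (0 : ℕ → Fin 2) from consDigit_head_tail 0] at h1
    exact h1.symm
  · simp only [Pi.smul_apply, smul_eq_mul, ← Finset.mul_sum]
    exact inv_mul_cancel₀ hσ
  · rw [hφ, Pi.smul_apply, extendByZero_smul, mul_inv_cancel_left₀ hσ]

theorem IsNormalizedEigenvector.exists_isContinuousRefinable {m : ℕ} {c : ℕ → ℝ}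
    {v : Fin (2 ^ m) → ℝ} (hv : IsNormalizedEigenvector m c v) (hρ : restrictedJSR m c v < 1) :
    ∃ φ, IsContinuousRefinable m c φ := by
  obtain ⟨γ, hγ, h0⟩ := exists_isRefinementCurve (m := m) (c := c) (v := v) hv.1 hρ
  refine hγ.exists_isContinuousRefinable fun h => ?_
  have := hv.2
  simp [← h0, h] at this

/-! ### The Hölder exponent -/

section Holder

variable {m : ℕ} {c : ℕ → ℝ} {γ : (ℕ → Fin 2) → Fin (2 ^ m) → ℝ} {φ : DyadicHalfLine → ℝ} {σ : ℝ}

theorem abs_extendByZero_le {N : ℕ} (x : Fin N → ℝ) (i : ℕ) : |extendByZero x i| ≤ ‖x‖ := by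
  by_cases hi : i < N
  · simp only [extendByZero, hi, dite_true]
    exact norm_le_pi_norm x _
  · rw [extendByZero_of_le x (not_lt.1 hi), abs_zero]
    exact norm_nonneg x

theorem exists_dyadicModulus_le (hγ : IsRefinementCurve m c γ)
    (hφ : ∀ i s, φ (point i s) = σ * extendByZero (γ s) i) {α : ℝ} (hα : 0 < α)
    (hρ : restrictedJSR m c (γ 0) < 2 ^ (-α)) :
    ∃ C : ℝ≥0, ∀ δ : ℝ, 0 < δ → dyadicModulus m φ δ ≤ C * ENNReal.ofReal (δ ^ α) := by
  obtain ⟨C, hC, hb⟩ := hγ.exists_norm_sub_le hρ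
  obtain ⟨K, hK0, hK⟩ := hγ.bounded
  -- `C * 2 ^ α` serves `δ ≤ 1`, and `2 * K`, the crude bound for any two values of the curve,
  -- serves `δ > 1`.
  have hD : 0 ≤ |σ| * (C * 2 ^ α + 2 * K) := by positivity
  refine ⟨(|σ| * (C * 2 ^ α + 2 * K)).toNNReal, fun δ hδ => ?_⟩
  refine iSup_le fun x => iSup_le fun y => iSup_le fun _ => iSup_le fun _ => iSup_le fun hyδ => ?_
  change _ ≤ ENNReal.ofReal (|σ| * (C * 2 ^ α + 2 * K)) * ENNReal.ofReal (δ ^ α)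
  rw [← ENNReal.ofReal_mul hD]
  refine ENNReal.ofReal_le_ofReal ?_
  obtain ⟨i, s, rfl⟩ := exists_eq_point x
  rw [mul_assoc]
  by_cases h1 : δ ≤ 1
  -- `2 ^ (-(r + 1)) < δ ≤ 2 ^ (-r)`: the upper bound yields agreement in `r` digits, the lower one
  -- costs the factor `2 ^ α`.
  · obtain ⟨r, hr1, hr2⟩ := exists_nat_pow_near_of_lt_one hδ h1 (by norm_num : (0 : ℝ) < 1 / 2)
      (by norm_num)
    obtain ⟨u, hu, rfl⟩ := exists_eq_point_zero_of_value_lt (x := y) (r := r) (by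
      refine hyδ.trans_le (hr2.trans_eq ?_)
      simp)
    rw [point_add_point, Nat.xor_zero, hφ, hφ, ← mul_sub, ← extendByZero_sub, abs_mul]
    refine mul_le_mul_of_nonneg_left ?_ (abs_nonneg σ)
    refine (abs_extendByZero_le _ _).trans ((hb r _ _ (agreeUpTo_add_self_right hu)).trans ?_)
    have h2 : ((2 : ℝ) ^ (-α)) ^ r ≤ 2 ^ α * δ ^ α := by
      rw [← Real.mul_rpow two_pos.le hδ.le, ← Real.rpow_natCast, ← Real.rpow_mul two_pos.le,
        mul_comm (-α), mul_neg, ← neg_mul, Real.rpow_mul two_pos.le]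
      refine Real.rpow_le_rpow (by positivity) ?_ hα.le
      rw [Real.rpow_neg two_pos.le, Real.rpow_natCast]
      rw [pow_succ, one_div, inv_pow] at hr1
      linarith
    calc C * ((2 : ℝ) ^ (-α)) ^ r ≤ C * (2 ^ α * δ ^ α) := mul_le_mul_of_nonneg_left h2 hC
      _ ≤ (C * 2 ^ α + 2 * K) * δ ^ α := by
        have : 0 ≤ 2 * K * δ ^ α := by positivity
        linarith
  · obtain ⟨j, u, rfl⟩ := exists_eq_point y
    rw [point_add_point, hφ, hφ, ← mul_sub, abs_mul]
    refine mul_le_mul_of_nonneg_left ?_ (abs_nonneg σ)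
    have h2 : 1 ≤ δ ^ α := Real.one_le_rpow (not_le.1 h1).le hα.le
    have h3 := (abs_extendByZero_le (γ (s + u)) (i ^^^ j)).trans (hK _)
    have h4 := (abs_extendByZero_le (γ s) i).trans (hK _)
    have h5 := abs_sub (extendByZero (γ (s + u)) (i ^^^ j)) (extendByZero (γ s) i)
    have h6 : 0 ≤ C * 2 ^ α := by positivity
    nlinarith

theorem norm_sub_le_of_dyadicModulus_le
    (hφ : ∀ i s, φ (point i s) = σ * extendByZero (γ s) i) (hσ : σ ≠ 0) {b : ℝ} (hb : 0 ≤ b)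
    {r k : ℕ} (hw : dyadicModulus m φ (2 ^ (-(r : ℤ))) ≤ ENNReal.ofReal b) {s s' : ℕ → Fin 2}
    (hs : ∀ n, k ≤ n → s n = 0) (hs' : ∀ n, k ≤ n → s' n = 0) (h : AgreeUpTo r s s') :
    ‖γ s' - γ s‖ ≤ b / |σ| := by
  have hσ' : 0 < |σ| := abs_pos.2 hσ
  rw [pi_norm_le_iff_of_nonneg (by positivity)]
  intro i
  have hu : ∀ n < r, (s + s') n = 0 := fun n hn => by
    rw [Pi.add_apply, h n hn]
    generalize s' n = a
    revert a
    decide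
  have hu' : ∀ n, k ≤ n → (s + s') n = 0 := fun n hn => by
    simp [hs n hn, hs' n hn]
  -- The modulus admits only values strictly below `2 ^ m` and `δ`. The eventually zero digits
  -- supply the zero that rules out equality.
  have h1 : ENNReal.ofReal |φ (point i s + point 0 (s + s')) - φ (point i s)| ≤
      dyadicModulus m φ (2 ^ (-(r : ℤ))) :=
    le_iSup_of_le (point i s) <| le_iSup_of_le (point 0 (s + s')) <|
      le_iSup_of_le (value_point_lt i.2 (hs k le_rfl)) <|
      le_iSup_of_le (value_point_lt (by positivity) (hu' k le_rfl)) <|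
      le_iSup_of_le (value_point_zero_lt hu (le_max_left r k) (hu' _ (le_max_right r k))) le_rfl
  have h2 := (ENNReal.ofReal_le_ofReal_iff hb).1 (h1.trans hw)
  rw [point_add_point, Nat.xor_zero, sequence_add_add_cancel, hφ, hφ, ← mul_sub,
    extendByZero_val, extendByZero_val, abs_mul] at h2
  rw [le_div_iff₀ hσ', mul_comm]
  exact h2

/-- The differences that control products of length `r` are increments of `γ` between finite digit
strings agreeing in `r` places. The modulus at `δ = 2 ^ (-r)` therefore bounds those products by a
multiple of `2 ^ (-α * r)`. -/
theorem restrictedJSR_le_of_dyadicModulus_le (hγ : IsRefinementCurve m c γ)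
    (hφ : ∀ i s, φ (point i s) = σ * extendByZero (γ s) i) (hσ : σ ≠ 0) {α : ℝ} {C : ℝ≥0}
    (hw : ∀ δ : ℝ, 0 < δ → dyadicModulus m φ δ ≤ C * ENNReal.ofReal (δ ^ α)) :
    restrictedJSR m c (γ 0) ≤ 2 ^ (-α) := by
  have hσ' : 0 < |σ| := abs_pos.2 hσ
  obtain ⟨D, hD, hb⟩ := exists_maxProductNorm_le m c (γ 0)
  rw [restrictedJSR_eq]
  refine jointSpectralRadius_le_of_maxProductNorm_le _ (by positivity) (C := D * (C / |σ|))
    fun r => ?_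
  have hpow : ((2 : ℝ) ^ (-(r : ℤ))) ^ α = (2 ^ (-α)) ^ r := by
    rw [← Real.rpow_natCast, ← Real.rpow_mul two_pos.le, zpow_neg, zpow_natCast,
      ← Real.rpow_natCast, ← Real.rpow_neg two_pos.le, ← Real.rpow_mul two_pos.le]
    congr 1
    ring
  have hw' := hw (2 ^ (-(r : ℤ))) (by positivity)
  rw [hpow, ← ENNReal.ofReal_coe_nnreal, ← ENNReal.ofReal_mul C.coe_nonneg] at hw'
  refine (hb r (C * (2 ^ (-α)) ^ r / |σ|) (by positivity) fun w w' hwr => ?_).trans_eq (by ring)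
  rw [hγ.wordMap_wordMap_sub]
  have hzero : ∀ w : List (Fin 2), ∀ n, w.length ≤ n → prependWord w 0 n = 0 := fun w n hn => by
    have := prependWord_add_length w 0 (n - w.length)
    rwa [Nat.sub_add_cancel hn] at this
  refine norm_sub_le_of_dyadicModulus_le hφ hσ (by positivity) hw' (k := (w ++ w').length)
    (fun n hn => hzero w n ?_) (fun n hn => ?_) ?_
  · rw [List.length_append] at hn
    omega
  · rw [← prependWord_append]
    exact hzero _ n hn
  · rw [← hwr]
    exact agreeUpTo_prependWord w _ _

theorem two_rpow_neg_le_iff {ρ α : ℝ} (hρ : 0 < ρ) : ρ ≤ 2 ^ (-α) ↔ α ≤ -Real.logb 2 ρ := by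
  rw [← Real.logb_le_iff_le_rpow one_lt_two hρ, le_neg]

theorem dyadicHolderExponent_eq (hγ : IsRefinementCurve m c γ)
    (hφ : ∀ i s, φ (point i s) = σ * extendByZero (γ s) i) (hσ : σ ≠ 0) :
    dyadicHolderExponent m φ = negLogTwo (restrictedJSR m c (γ 0)) := by
  have hρ1 := hγ.restrictedJSR_lt_one
  have hρ0 : 0 ≤ restrictedJSR m c (γ 0) := jointSpectralRadius_nonneg _
  have hmem : ∀ α : ℝ, 0 < α → restrictedJSR m c (γ 0) < 2 ^ (-α) →
      (α : EReal) ≤ dyadicHolderExponent m φ := fun α hα h =>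
    le_iSup_of_le α <| le_iSup_of_le hα <| le_iSup_of_le (exists_dyadicModulus_le hγ hφ hα h) le_rfl
  refine le_antisymm ?_ ?_
  · refine iSup_le fun α => iSup_le fun hα => iSup_le fun ⟨C, hC⟩ => ?_
    have h := restrictedJSR_le_of_dyadicModulus_le hγ hφ hσ hC
    rw [negLogTwo]
    split_ifs with h0
    · exact le_top
    · exact_mod_cast (two_rpow_neg_le_iff (hρ0.lt_of_ne' h0)).1 h
  · rw [negLogTwo]
    split_ifs with h0
    -- For `ρ = 0` every `α > 0` satisfies `ρ < 2 ^ (-α)`, so the exponent exceeds each real `y`.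
    · refine (EReal.eq_top_iff_forall_lt _).2 (fun y => ?_) |>.ge
      refine lt_of_lt_of_le ?_ (hmem (max y 0 + 1) (by positivity) (by rw [h0]; positivity))
      exact_mod_cast (le_max_left y 0).trans_lt (lt_add_one _)
    · have hpos := hρ0.lt_of_ne' h0
      have hL : 0 < -Real.logb 2 (restrictedJSR m c (γ 0)) :=
        neg_pos.2 (Real.logb_neg one_lt_two hpos hρ1)
      have hlt : ∀ α, 0 < α → α < -Real.logb 2 (restrictedJSR m c (γ 0)) →
          (α : EReal) ≤ dyadicHolderExponent m φ := fun α hα h => by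
        refine hmem α hα ?_
        rwa [← Real.logb_lt_iff_lt_rpow one_lt_two hpos, lt_neg]
      refine le_of_forall_lt_imp_le_of_dense fun a ha => ?_
      -- Only positive exponents are admitted, hence the maximum with `0`; there is room above it
      -- since `ρ < 1` makes `-log₂ ρ` positive.
      obtain ⟨b, hab, hb⟩ := EReal.lt_iff_exists_real_btwn.1 (max_lt ha (show ((0 : ℝ) : EReal) <
        ((-Real.logb 2 (restrictedJSR m c (γ 0)) : ℝ) : EReal) from EReal.coe_lt_coe_iff.2 hL))
      exact (le_max_left _ _).trans (hab.le.trans (hlt b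
        (EReal.coe_lt_coe_iff.1 ((le_max_right _ _).trans_lt hab)) (EReal.coe_lt_coe_iff.1 hb)))

end Holder

/-! ### The three assertions of the theorem -/

theorem mainTheorem2 (m : ℕ) (c : ℕ → ℝ)
    (heven : ∑ k ∈ Finset.range (2 ^ m), c (2 * k) = 1)
    (hodd : ∑ k ∈ Finset.range (2 ^ m), c (2 * k + 1) = 1) :
    (∀ v, IsNormalizedEigenvector m c v → (∀ w, IsNormalizedEigenvector m c w → w = v) →
      ((∃ φ, IsContinuousRefinable m c φ) ↔ restrictedJSR m c v < 1)) ∧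
    ((∃ φ, IsContinuousRefinable m c φ) ↔
      ∃ v, IsNormalizedEigenvector m c v ∧ restrictedJSR m c v < 1) ∧
    (∀ φ v, IsContinuousRefinable m c φ → IsNormalizedEigenvector m c v →
      restrictedJSR m c v < 1 →
      dyadicHolderExponent m φ = negLogTwo (restrictedJSR m c v)) := by
  refine ⟨fun v hv huniq => ⟨fun ⟨φ, hφ⟩ => ?_, hv.exists_isContinuousRefinable⟩,
    ⟨fun ⟨φ, hφ⟩ => ?_, fun ⟨v, hv, hρ⟩ => hv.exists_isContinuousRefinable hρ⟩,
    fun φ v hφ hv hρ => ?_⟩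
  · obtain ⟨σ, γ, -, hγ, h0, -⟩ := hφ.exists_normalized_curve
    rw [← huniq _ h0]
    exact hγ.restrictedJSR_lt_one
  · obtain ⟨σ, γ, -, hγ, h0, -⟩ := hφ.exists_normalized_curve
    exact ⟨γ 0, h0, hγ.restrictedJSR_lt_one⟩
  · obtain ⟨σ, γ, hσ, hγ, h0, hφγ⟩ := hφ.exists_normalized_curve
    obtain ⟨γ', hγ', h0'⟩ := exists_isRefinementCurve (m := m) (c := c) (v := v) hv.1 hρ
    -- Both curves start at vectors of coordinate sum `1`, so rigidity identifies them, and `v` is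
    -- the initial point of the curve of `φ` even if `T₀` has other normalized eigenvectors.
    have : γ = γ' := hγ.eq_of_sum_eq hγ' (by rw [h0.2, h0', hv.2])
    rw [← h0', ← this]
    exact dyadicHolderExponent_eq hγ hφγ hσ
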